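/- Let $(M,\langle\cdot,\cdot\rangle)$ be a smooth Riemannian manifold (without boundary) of dimension $m$, with Levi-Civita connection $\nabla$, Ricci tensor $\mathrm{Ric}$, scalar curvature $S=\mathrm{tr}\,\mathrm{Ric}$ and Laplace--Beltrami operator $\Delta=\mathrm{div}\,\nabla$. Let $X$ be a smooth vector field on $M$ and $\lambda\in\mathbb R$ a constant such that $(X,\lambda)$ is a Ricci soliton, that is, \[ \mathrm{Ric}+\tfrac12\,\mathcal L_X\langle\cdot,\cdot\rangle=\lambda\,\langle\cdot,\cdot\rangle , \] where $\mathcal L_X$ denotes the Lie derivative in the direction of $X$. Then $S$ is smooth and, at every point of $M$, \[ \tfrac12\Delta S=\tfrac12\langle\nabla S,X\rangle+\lambda S-|\mathrm{Ric}|^2 \] and \[ \tfrac12\Delta S=\tfrac12\langle\nabla S,X\rangle+\lambda S-\frac{S^2}{m}-\Big|\mathrm{Ric}-\frac Sm\langle\cdot,\cdot\rangle\Big|^2 . \] (For $m=0$ the quotients $S^2/m$ and $S/m$ are read as $0$.) -/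

import Mathlib

open Bundle FiberBundle VectorField
open scoped Manifold ContDiff Topology

set_option linter.unusedSectionVars false

noncomputable section

namespace Riem

section General

variable {E : Type*} [NormedAddCommGroup E] [NormedSpace ℝ E] [FiniteDimensional ℝ E]
  {H : Type*} [TopologicalSpace H] {I : ModelWithCorners ℝ E H}
  {M : Type*} [TopologicalSpace M] [ChartedSpace H M] [IsManifold I ∞ M]
  [RiemannianBundle (fun x : M ↦ TangentSpace I x)]
  [IsContMDiffRiemannianBundle I ∞ E (fun x : M ↦ TangentSpace I x)]

instance finiteDimensional_tangentSpace (x : M) : FiniteDimensional ℝ (TangentSpace I x) :=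
  inferInstanceAs (FiniteDimensional ℝ E)

instance isContMDiffRiemannianBundle_one :
    IsContMDiffRiemannianBundle I 1 E (fun x : M ↦ TangentSpace I x) :=
  IsContMDiffRiemannianBundle.of_le (n := ∞) (by norm_cast)

variable (I) in
/-- An orthonormal basis of the tangent space at `x`; traces and norms below are computed in it
and do not depend on its choice. -/
def onb (x : M) :
    OrthonormalBasis (Fin (Module.finrank ℝ (TangentSpace I x))) ℝ (TangentSpace I x) :=
  stdOrthonormalBasis ℝ (TangentSpace I x)

/-- The right-hand side of the Koszul formula
`2⟨∇_X Y, Z⟩ = X⟨Y,Z⟩ + Y⟨Z,X⟩ - Z⟨X,Y⟩ + ⟨[X,Y],Z⟩ - ⟨[Y,Z],X⟩ + ⟨[Z,X],Y⟩`. -/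
def koszul (Y X Z : Π x : M, TangentSpace I x) (x : M) : ℝ :=
  mvfderiv I (fun y ↦ inner ℝ (Y y) (Z y)) x (X x)
    + mvfderiv I (fun y ↦ inner ℝ (Z y) (X y)) x (Y x)
    - mvfderiv I (fun y ↦ inner ℝ (X y) (Y y)) x (Z x)
    + inner ℝ (mlieBracket I X Y x) (Z x)
    - inner ℝ (mlieBracket I Y Z x) (X x)
    + inner ℝ (mlieBracket I Z X x) (Y x)

theorem mdiff_inner {Y Z : Π x : M, TangentSpace I x} {x : M}
    (hY : MDiffAt (T% Y) x) (hZ : MDiffAt (T% Z) x) :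
    MDiffAt (fun y ↦ inner ℝ (Y y) (Z y)) x :=
  MDifferentiableAt.inner_bundle (F := E) (E := fun x : M ↦ TangentSpace I x) (b := id) hY hZ

theorem koszul_tensorial_left {Y Z : Π x : M, TangentSpace I x} {x : M}
    (hY : MDiffAt (T% Y) x) (hZ : MDiffAt (T% Z) x) :
    TensorialAt I E (fun X ↦ koszul Y X Z x) x where
  smul {f X} hf hX := by
    simp [koszul, inner_smul_left, inner_smul_right, inner_add_left,
      mvfderiv_fun_mul hf (mdiff_inner hX hY), mvfderiv_fun_mul hf (mdiff_inner hZ hX),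
      mlieBracket_smul_left hf hX, mlieBracket_smul_right hf hX, real_inner_comm (X x) (Z x)]
    ring
  add {X X'} hX hX' := by
    simp [koszul, inner_add_left, inner_add_right,
      mvfderiv_fun_add (mdiff_inner hX hY) (mdiff_inner hX' hY),
      mvfderiv_fun_add (mdiff_inner hZ hX) (mdiff_inner hZ hX'),
      mlieBracket_add_left hX hX', mlieBracket_add_right hX hX']
    ring

theorem koszul_tensorial_right {Y X : Π x : M, TangentSpace I x} {x : M}
    (hY : MDiffAt (T% Y) x) (hX : MDiffAt (T% X) x) :
    TensorialAt I E (fun Z ↦ koszul Y X Z x) x where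
  smul {f Z} hf hZ := by
    simp [koszul, inner_smul_left, inner_smul_right, inner_add_left,
      mvfderiv_fun_mul hf (mdiff_inner hY hZ), mvfderiv_fun_mul hf (mdiff_inner hZ hX),
      mlieBracket_smul_left hf hZ, mlieBracket_smul_right hf hZ, real_inner_comm (Z x) (Y x)]
    ring
  add {Z Z'} hZ hZ' := by
    simp [koszul, inner_add_left, inner_add_right,
      mvfderiv_fun_add (mdiff_inner hY hZ) (mdiff_inner hY hZ'),
      mvfderiv_fun_add (mdiff_inner hZ hX) (mdiff_inner hZ' hX),
      mlieBracket_add_left hZ hZ', mlieBracket_add_right hZ hZ']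
    ring

theorem koszul_add {Y Y' X Z : Π x : M, TangentSpace I x} {x : M}
    (hY : MDiffAt (T% Y) x) (hY' : MDiffAt (T% Y') x) (hX : MDiffAt (T% X) x)
    (hZ : MDiffAt (T% Z) x) :
    koszul (Y + Y') X Z x = koszul Y X Z x + koszul Y' X Z x := by
  simp [koszul, inner_add_left, inner_add_right,
    mvfderiv_fun_add (mdiff_inner hY hZ) (mdiff_inner hY' hZ),
    mvfderiv_fun_add (mdiff_inner hX hY) (mdiff_inner hX hY'),
    mlieBracket_add_left hY hY', mlieBracket_add_right hY hY']
  ring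

theorem koszul_leibniz {Y X Z : Π x : M, TangentSpace I x} {f : M → ℝ} {x : M}
    (hY : MDiffAt (T% Y) x) (hf : MDiffAt f x) (hX : MDiffAt (T% X) x)
    (hZ : MDiffAt (T% Z) x) :
    koszul (f • Y) X Z x
      = f x * koszul Y X Z x + 2 * (mvfderiv I f x (X x) * inner ℝ (Y x) (Z x)) := by
  simp [koszul, inner_smul_left, inner_smul_right, inner_add_left,
    mvfderiv_fun_mul hf (mdiff_inner hY hZ), mvfderiv_fun_mul hf (mdiff_inner hX hY),
    mlieBracket_smul_left hf hY, mlieBracket_smul_right hf hY, real_inner_comm (Y x) (X x)]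
  ring

open scoped Classical in
/-- The covariant derivative `v ↦ ∇_v Y` at `x`: the endomorphism of the tangent space whose inner
products are given by the Koszul formula (and `0` if `Y` is not differentiable at `x`). -/
def leviCivitaFun (Y : Π x : M, TangentSpace I x) (x : M) :
    TangentSpace I x →L[ℝ] TangentSpace I x :=
  if hY : MDiffAt (T% Y) x then
    (1 / 2 : ℝ) • ∑ i, ((TensorialAt.mkHom₂ (fun X Z ↦ koszul Y X Z x) x
      (fun _ hZ ↦ koszul_tensorial_left hY hZ)
      (fun _ hX ↦ koszul_tensorial_right hY hX)).flip (onb I x i)).smulRight (onb I x i)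
  else 0

theorem two_mul_inner_leviCivitaFun {Y X Z : Π x : M, TangentSpace I x} {x : M}
    (hY : MDiffAt (T% Y) x) (hX : MDiffAt (T% X) x) (hZ : MDiffAt (T% Z) x) :
    2 * inner ℝ (leviCivitaFun Y x (X x)) (Z x) = koszul Y X Z x := by
  rw [leviCivitaFun, dif_pos hY]
  set B := TensorialAt.mkHom₂ (fun X Z ↦ koszul Y X Z x) x
      (fun _ hZ ↦ koszul_tensorial_left hY hZ)
      (fun _ hX ↦ koszul_tensorial_right hY hX) with hB
  have h1 : B (X x) (Z x) = koszul Y X Z x := TensorialAt.mkHom₂_apply _ _ hX hZ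
  rw [← h1]
  conv_rhs => rw [← (onb I x).sum_repr' (Z x)]
  simp [sum_inner, inner_smul_left, Finset.mul_sum, mul_comm]

theorem isCovariantDerivativeOn_leviCivitaFun :
    IsCovariantDerivativeOn E
      (leviCivitaFun : (Π x : M, TangentSpace I x) → _) Set.univ where
  add {Y Y' x} hY hY' _ := by
    ext v
    refine ext_inner_right ℝ fun w ↦ ?_
    have hv := mdifferentiableAt_extend I E v
    have hw := mdifferentiableAt_extend I E w
    have h1 := two_mul_inner_leviCivitaFun hY hv hw
    have h2 := two_mul_inner_leviCivitaFun hY' hv hw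
    have h3 := two_mul_inner_leviCivitaFun (mdifferentiableAt_add_section hY hY') hv hw
    rw [koszul_add hY hY' hv hw] at h3
    simp only [extend_apply_self] at h1 h2 h3
    simp only [add_apply, inner_add_left]
    linarith
  leibniz {Y f x} hY hf _ := by
    ext v
    refine ext_inner_right ℝ fun w ↦ ?_
    have hv := mdifferentiableAt_extend I E v
    have hw := mdifferentiableAt_extend I E w
    have h1 := two_mul_inner_leviCivitaFun hY hv hw
    have h3 := two_mul_inner_leviCivitaFun (hf.smul_section hY) hv hw
    rw [koszul_leibniz hY hf hv hw] at h3
    simp only [extend_apply_self] at h1 h3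
    simp [inner_add_left, inner_smul_left]
    linear_combination (1 / 2) * h3 - (f x / 2) * h1

variable (I M) in
/-- The Levi-Civita connection; `leviCivita I M Y x v` is `∇_v Y` at `x`. -/
def leviCivita : CovariantDerivative I E (fun x : M ↦ TangentSpace I x) where
  toFun := leviCivitaFun
  isCovariantDerivativeOnUniv := isCovariantDerivativeOn_leviCivitaFun

theorem leviCivita_torsion : (leviCivita I M).torsion = 0 := by
  rw [CovariantDerivative.torsion_eq_zero_iff]
  intro X Y x hX hY
  refine ext_inner_right ℝ fun w ↦ ?_
  have hw := mdifferentiableAt_extend I E w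
  have h1 := two_mul_inner_leviCivitaFun hY hX hw
  have h2 := two_mul_inner_leviCivitaFun hX hY hw
  change inner ℝ (leviCivitaFun Y x (X x) - leviCivitaFun X x (Y x)) w = _
  simp only [koszul, extend_apply_self, mlieBracket_swap_apply (V := Y) (W := X),
    mlieBracket_swap_apply (V := extend E w) (W := X),
    mlieBracket_swap_apply (V := extend E w) (W := Y), inner_neg_left] at h1 h2
  simp only [real_inner_comm (Y _) (X _), real_inner_comm (extend E w _) (X _),
    real_inner_comm (extend E w _) (Y _)] at h1 h2
  rw [inner_sub_left]
  linarith

theorem leviCivita_metric {X Y Z : Π x : M, TangentSpace I x} {x : M}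
    (hX : MDiffAt (T% X) x) (hY : MDiffAt (T% Y) x) (hZ : MDiffAt (T% Z) x) :
    mvfderiv I (fun y ↦ inner ℝ (Y y) (Z y)) x (X x)
      = inner ℝ (leviCivita I M Y x (X x)) (Z x) + inner ℝ (Y x) (leviCivita I M Z x (X x)) := by
  have h1 := two_mul_inner_leviCivitaFun hY hX hZ
  have h2 := two_mul_inner_leviCivitaFun hZ hX hY
  change _ = inner ℝ (leviCivitaFun Y x (X x)) (Z x) + inner ℝ (Y x) (leviCivitaFun Z x (X x))
  simp only [koszul, mlieBracket_swap_apply (V := Y) (W := X),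
    mlieBracket_swap_apply (V := Z) (W := X),
    mlieBracket_swap_apply (V := Z) (W := Y), inner_neg_left] at h1 h2
  simp only [real_inner_comm (Y _) (X _), real_inner_comm (Z _) (X _),
    real_inner_comm (Z _) (Y _)] at h1 h2
  rw [real_inner_comm _ (Y x)]
  simp only [real_inner_comm (Z _) (Y _)]
  linarith

/-- `R(U,V)W = ∇_U ∇_V W - ∇_V ∇_U W - ∇_{[U,V]} W`. -/
def curvature (U V W : Π x : M, TangentSpace I x) (x : M) : TangentSpace I x :=
  leviCivita I M (fun y ↦ leviCivita I M W y (V y)) x (U x)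
    - leviCivita I M (fun y ↦ leviCivita I M W y (U y)) x (V x)
    - leviCivita I M W x (mlieBracket I U V x)

/-- The Riemann tensor `R(u,v)w` on tangent vectors at `x`, computed by extending them to vector
fields that are smooth near `x`. -/
def riemannTensor (x : M) (u v w : TangentSpace I x) : TangentSpace I x :=
  curvature (extend E u) (extend E v) (extend E w) x

/-- `Ric(u,v)` is the trace of `e ↦ R(e,u)v`. -/
def ricci (x : M) (u v : TangentSpace I x) : ℝ :=
  ∑ i, inner ℝ (riemannTensor x (onb I x i) u v) (onb I x i)

variable (I) in
/-- Scalar curvature. -/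
def scalarCurvature (x : M) : ℝ := ∑ i, ricci x (onb I x i) (onb I x i)

/-- The squared norm `|B|²` of a bilinear form on the tangent space at `x`. -/
def normSq {x : M} (B : TangentSpace I x → TangentSpace I x → ℝ) : ℝ :=
  ∑ i, ∑ j, B (onb I x i) (onb I x j) ^ 2

variable (I) in
/-- The gradient of `f`. -/
def gradient (f : M → ℝ) (x : M) : TangentSpace I x :=
  ∑ i, mvfderiv I f x (onb I x i) • onb I x i

/-- The divergence of a vector field. -/
def divergence (Y : Π x : M, TangentSpace I x) (x : M) : ℝ :=
  ∑ i, inner ℝ (leviCivita I M Y x (onb I x i)) (onb I x i)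

variable (I) in
/-- The Laplace-Beltrami operator `Δf = div ∇f`. -/
def laplacian (f : M → ℝ) (x : M) : ℝ := divergence (gradient I f) x

/-- The Lie derivative of the metric,
`(L_X g)(Y,Z) = X⟨Y,Z⟩ - ⟨[X,Y],Z⟩ - ⟨Y,[X,Z]⟩`, on tangent vectors `u`, `v` at `x` extended to
vector fields that are smooth near `x`. -/
def lieDerivMetric (X : Π x : M, TangentSpace I x) (x : M) (u v : TangentSpace I x) : ℝ :=
  mvfderiv I (fun y ↦ inner ℝ (extend E u y) (extend E v y)) x (X x)
    - inner ℝ (mlieBracket I X (extend E u) x) v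
    - inner ℝ u (mlieBracket I X (extend E v) x)

/-- `(X, lam)` is a Ricci soliton: `X` is a smooth vector field and `Ric + ½ L_X g = lam g`. -/
structure IsRicciSoliton (X : Π x : M, TangentSpace I x) (lam : ℝ) : Prop where
  contMDiff : ContMDiff I I.tangent ∞ (T% X)
  eq : ∀ (x : M) (u v : TangentSpace I x),
    ricci x u v + 1 / 2 * lieDerivMetric X x u v = lam * inner ℝ u v

end General

end Riem

end

/-! The trace of the soliton equation gives `d(div X) = -dS`. Its divergence, combined with the
commutation rule `div (∇X)ᵀ = Ric(·,X) + d(div X)` and the contracted Bianchi identity `dS = 2 div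
Ric`, gives `div ∇X = -Ric(·,X)`. Hence the skew form `∇X - (∇X)ᵀ` has divergence `dS - 2 Ric(·,X)`.
The double divergence of a skew form vanishes, so `ΔS = 2 div(Ric(·,X)) = 2 (div Ric)(X) +
2⟨Ric,∇X⟩`. The first term is `⟨∇S,X⟩`; in the second only the symmetric part of `∇X` counts, and
the soliton equation says that it is `λg - Ric`. This is `div_grad_S`, which rests on `D_S`,
`divT_flip_nabla` and `div_divT_eq_zero`. The second formula splits `|Ric|²` into trace and
traceless parts (`normSq_sub_trace`).

The computation is pure algebra in a `FramedGeometry`. A manifold supplies one near each point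
(`IsOrthonormalFrame.geometry`): functions smooth on the domain `s` of an orthonormal frame, and
fields smooth on `s` that vanish off `s`. Because the fields vanish there, the identities between
total functions on `M` hold off `s` as well. The pointwise definitions use chosen extensions of
vectors and, at each point, an orthonormal basis unrelated to the frame; tensoriality
(`riemannTensor_apply`) and basis independence of traces (`trace_eq`) identify them with the
algebraic objects. -/

/-- The algebraic skeleton of Riemannian geometry on an open set with an orthonormal frame: a ring
`A` of functions, a module `𝔛` of vector fields acting on `A` by derivations `D`, a metric `g`, a
metric and torsion-free connection `N` (so `N U V = ∇_U V`) and a frame `e`. -/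
structure FramedGeometry (A 𝔛 ι : Type*) [CommRing A] [Algebra ℝ A] [AddCommGroup 𝔛] [Module A 𝔛]
    [Fintype ι] where
  D : 𝔛 →ₗ[A] Derivation ℝ A A
  N : 𝔛 →ₗ[A] 𝔛 →+ 𝔛
  g : 𝔛 →ₗ[A] 𝔛 →ₗ[A] A
  e : ι → 𝔛
  leibniz : ∀ U V (f : A), N U (f • V) = f • N U V + D U f • V
  g_comm : ∀ U V, g U V = g V U
  metric : ∀ U V W, D U (g V W) = g (N U V) W + g V (N U W)
  D_comm : ∀ U V f, D U (D V f) - D V (D U f) = D (N U V - N V U) f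
  jacobi : ∀ U V W,
    N U (N V W - N W V) - N (N V W - N W V) U + (N V (N W U - N U W) - N (N W U - N U W) V)
      + (N W (N U V - N V U) - N (N U V - N V U) W) = 0
  sum_frame : ∀ V, ∑ i, g V (e i) • e i = V
  D_frame : ∀ U i j, D U (g (e i) (e j)) = 0

namespace FramedGeometry

variable {A 𝔛 ι : Type*} [CommRing A] [Algebra ℝ A] [AddCommGroup 𝔛] [Module A 𝔛] [Fintype ι]

/-- `A` may have zero divisors, but 2 is a unit in any `ℝ`-algebra. -/
theorem eq_of_two_mul_eq {a b : A} (h : 2 * a = 2 * b) : a = b := by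
  have h2 : algebraMap ℝ A (1 / 2) * 2 = 1 := by
    rw [← map_ofNat (algebraMap ℝ A) 2, ← map_mul]; norm_num
  linear_combination (exp := 1) algebraMap ℝ A (1 / 2) * h - (a - b) * h2

/-! ### Curvature symmetries and the Bianchi identities. -/

variable (G : FramedGeometry A 𝔛 ι)

/-- The curvature operator `W ↦ R(U,V)W`. -/
def curvEnd (U V : 𝔛) : 𝔛 →ₗ[A] 𝔛 where
  toFun W := G.N U (G.N V W) - G.N V (G.N U W) - G.N (G.N U V - G.N V U) W
  map_add' W W' := by simp only [map_add]; abel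
  map_smul' f W := by
    -- The second derivatives of `f` enter only through their commutator, which `D_comm` cancels
    -- against the bracket term.
    simp only [leibniz, map_add, RingHom.id_apply, ← G.D_comm U V f, sub_smul]
    module

/-- The Riemann tensor `R(U,V)W`. -/
def R : 𝔛 →ₗ[A] 𝔛 →ₗ[A] 𝔛 →ₗ[A] 𝔛 :=
  LinearMap.mk₂ A G.curvEnd
    (fun U U' V ↦ by
      ext W; simp only [curvEnd, LinearMap.coe_mk, AddHom.coe_mk, LinearMap.add_apply, map_add,
        map_sub, AddMonoidHom.add_apply, AddMonoidHom.sub_apply]; abel)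
    (fun f U V ↦ by
      ext W; simp only [curvEnd, LinearMap.coe_mk, AddHom.coe_mk, LinearMap.smul_apply, map_smul,
        map_sub, AddMonoidHom.smul_apply, AddMonoidHom.sub_apply, leibniz, map_add,
        AddMonoidHom.add_apply]
      module)
    (fun U V V' ↦ by
      ext W; simp only [curvEnd, LinearMap.coe_mk, AddHom.coe_mk, LinearMap.add_apply, map_add,
        map_sub, AddMonoidHom.add_apply, AddMonoidHom.sub_apply]; abel)
    (fun f U V ↦ by
      ext W; simp only [curvEnd, LinearMap.coe_mk, AddHom.coe_mk, LinearMap.smul_apply, map_smul,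
        map_sub, AddMonoidHom.smul_apply, AddMonoidHom.sub_apply, leibniz, map_add,
        AddMonoidHom.add_apply]
      module)

theorem R_apply (U V W : 𝔛) :
    G.R U V W = G.N U (G.N V W) - G.N V (G.N U W) - G.N (G.N U V - G.N V U) W := rfl

/-- The operator `U ↦ R(U,V)W`. -/
def RFst (V W : 𝔛) : 𝔛 →ₗ[A] 𝔛 := (G.R.flip V).flip W

theorem RFst_apply (U V W : 𝔛) : G.RFst V W U = G.R U V W := rfl

/-- The operator `V ↦ R(U,V)W`. -/
def RSnd (U W : 𝔛) : 𝔛 →ₗ[A] 𝔛 := (G.R U).flip W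

theorem RSnd_apply (U V W : 𝔛) : G.RSnd U W V = G.R U V W := rfl

theorem R_swap (U V W : 𝔛) : G.R U V W = -G.R V U W := by
  simp only [R_apply, map_sub, AddMonoidHom.sub_apply]; abel

theorem bianchi_first (U V W : 𝔛) : G.R U V W + G.R V W U + G.R W U V = 0 := by
  rw [← G.jacobi U V W]
  simp only [R_apply, map_sub, AddMonoidHom.sub_apply]; abel

/-- Applying the commutator of derivatives to the function `g W Z` and expanding by metric
compatibility leaves exactly the two curvature terms. -/
theorem g_R_skew (U V W Z : 𝔛) : G.g (G.R U V W) Z = -G.g (G.R U V Z) W := by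
  have h := G.D_comm U V (G.g W Z)
  simp only [metric, map_add] at h
  rw [G.g_comm (G.R U V Z) W]
  simp only [R_apply, map_sub, AddMonoidHom.sub_apply, LinearMap.sub_apply] at h ⊢
  linear_combination (exp := 1) h

/-- The classical octahedron argument: four instances of the first Bianchi identity, combined
through the two skew symmetries, leave twice the claim. -/
theorem g_R_pair (U V W Z : 𝔛) : G.g (G.R U V W) Z = G.g (G.R W Z U) V := by
  have b (U V W Z : 𝔛) :
      G.g (G.R U V W) Z + G.g (G.R V W U) Z + G.g (G.R W U V) Z = 0 := by
    rw [← LinearMap.add_apply, ← map_add, ← LinearMap.add_apply, ← map_add, bianchi_first,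
      map_zero, LinearMap.zero_apply]
  have s (U V W Z : 𝔛) : G.g (G.R U V W) Z = -G.g (G.R V U W) Z := by
    rw [R_swap, map_neg, LinearMap.neg_apply]
  have k := G.g_R_skew
  have main (U V W Z : 𝔛) : G.g (G.R V W U) Z = G.g (G.R U Z V) W := by
    apply eq_of_two_mul_eq
    linear_combination (exp := 1) b U V W Z - b V W Z U - b W Z U V + b Z U V W + k V W U Z
      + k W Z U V - k U V W Z + s Z V W U - k V Z W U + k Z U V W - 2 * s Z U V W - s W U V Z
      + k U W V Z
  exact main W U V Z

/-- The covariant derivative `(∇_U R)(V,W)Z` of the Riemann tensor. -/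
def DR (U V W Z : 𝔛) : 𝔛 :=
  G.N U (G.R V W Z) - G.R (G.N U V) W Z - G.R V (G.N U W) Z - G.R V W (G.N U Z)

/-- The triple commutators of the operators `∇_U`, `∇_V`, `∇_W` cancel formally; what remains is the
derivative of `Z` along the Jacobi sum of brackets, which is zero. -/
theorem bianchi_second (U V W Z : 𝔛) : G.DR U V W Z + G.DR V W U Z + G.DR W U V Z = 0 := by
  have h := congrArg (fun Y ↦ G.N Y Z) (G.jacobi U V W)
  simp only [map_sub, map_add, AddMonoidHom.sub_apply, AddMonoidHom.add_apply, map_zero,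
    AddMonoidHom.zero_apply] at h
  rw [← neg_eq_zero] at h
  rw [← h]
  simp only [DR, R_apply, map_sub, AddMonoidHom.sub_apply]
  abel

/-! ### Traces -/

theorem N_frame (U : 𝔛) (i : ι) : G.N U (G.e i) = ∑ j, G.g (G.N U (G.e i)) (G.e j) • G.e j :=
  (G.sum_frame _).symm

theorem connection_skew (U : 𝔛) (i j : ι) :
    G.g (G.N U (G.e i)) (G.e j) + G.g (G.N U (G.e j)) (G.e i) = 0 := by
  rw [← G.D_frame U i j, G.metric, G.g_comm (G.e i)]

/-- The connection coefficients of the frame are skew in their two indices, so differentiating the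
frame contributes nothing to a trace. -/
theorem sum_frame_skew (T : 𝔛 →ₗ[A] 𝔛 →ₗ[A] A) (U : 𝔛) :
    ∑ i, (T (G.N U (G.e i)) (G.e i) + T (G.e i) (G.N U (G.e i))) = 0 := by
  have h1 : ∑ i, T (G.N U (G.e i)) (G.e i)
      = ∑ i, ∑ j, G.g (G.N U (G.e j)) (G.e i) * T (G.e i) (G.e j) := by
    rw [Finset.sum_comm]
    refine Finset.sum_congr rfl fun i _ ↦ ?_
    conv_lhs => rw [G.N_frame U i]
    simp [map_sum, LinearMap.sum_apply]
  have h2 : ∑ i, T (G.e i) (G.N U (G.e i))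
      = ∑ i, ∑ j, G.g (G.N U (G.e i)) (G.e j) * T (G.e i) (G.e j) := by
    refine Finset.sum_congr rfl fun i _ ↦ ?_
    conv_lhs => rw [G.N_frame U i]
    simp [map_sum]
  rw [Finset.sum_add_distrib, h1, h2, ← Finset.sum_add_distrib]
  refine Finset.sum_eq_zero fun i _ ↦ ?_
  rw [← Finset.sum_add_distrib]
  refine Finset.sum_eq_zero fun j _ ↦ ?_
  rw [← add_mul, G.connection_skew U j i, zero_mul]

/-- Contraction commutes with covariant differentiation. -/
theorem D_trace (T : 𝔛 →ₗ[A] 𝔛 →ₗ[A] A) (U : 𝔛) :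
    G.D U (∑ i, T (G.e i) (G.e i)) = ∑ i, (G.D U (T (G.e i) (G.e i))
      - T (G.N U (G.e i)) (G.e i) - T (G.e i) (G.N U (G.e i))) := by
  have h := G.sum_frame_skew T U
  simp only [map_sum, Finset.sum_sub_distrib, Finset.sum_add_distrib] at h ⊢
  linear_combination (exp := 1) h

/-- The Ricci tensor. -/
def Ric : 𝔛 →ₗ[A] 𝔛 →ₗ[A] A := ∑ i, (G.R (G.e i)).compr₂ (G.g.flip (G.e i))

theorem Ric_apply (U V : 𝔛) : G.Ric U V = ∑ i, G.g (G.R (G.e i) U V) (G.e i) := by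
  simp [Ric, LinearMap.sum_apply]

theorem Ric_comm (U V : 𝔛) : G.Ric U V = G.Ric V U := by
  simp only [Ric_apply]
  refine Finset.sum_congr rfl fun i _ ↦ ?_
  rw [g_R_pair, g_R_skew, R_swap, map_neg, LinearMap.neg_apply, neg_neg]

/-- Scalar curvature. -/
def S : A := ∑ i, G.Ric (G.e i) (G.e i)

/-- The covariant derivative `(∇_U T)(V,W)` of a bilinear form. -/
def DT (T : 𝔛 →ₗ[A] 𝔛 →ₗ[A] A) (U V W : 𝔛) : A :=
  G.D U (T V W) - T (G.N U V) W - T V (G.N U W)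

theorem g_DR (U V W Z Y : 𝔛) : G.g (G.DR U V W Z) Y
    = G.D U (G.g (G.R V W Z) Y) - G.g (G.R (G.N U V) W Z) Y - G.g (G.R V (G.N U W) Z) Y
      - G.g (G.R V W (G.N U Z)) Y - G.g (G.R V W Z) (G.N U Y) := by
  simp only [DR, metric, map_sub, LinearMap.sub_apply]; ring

theorem g_DR_skew (U V W Z Y : 𝔛) : G.g (G.DR U V W Z) Y = -G.g (G.DR U V W Y) Z := by
  simp only [g_DR]
  rw [G.g_R_skew V W Z, G.g_R_skew (G.N U V) W Z, G.g_R_skew V (G.N U W) Z,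
    G.g_R_skew V W (G.N U Z), G.g_R_skew V W Z, map_neg]
  ring

theorem DR_swap (U V W Z : 𝔛) : G.DR U V W Z = -G.DR U W V Z := by
  simp only [DR]
  rw [G.R_swap V W Z, G.R_swap (G.N U V) W, G.R_swap V (G.N U W), G.R_swap V W (G.N U Z), map_neg]
  abel

/-- The bilinear form `(Y,Z) ↦ ⟨R(Y,V)W, Z⟩`. -/
def curvForm (V W : 𝔛) : 𝔛 →ₗ[A] 𝔛 →ₗ[A] A :=
  LinearMap.mk₂ A (fun Y Z ↦ G.g (G.R Y V W) Z) (by simp) (by simp) (by simp) (by simp)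

theorem curvForm_apply (V W Y Z : 𝔛) : G.curvForm V W Y Z = G.g (G.R Y V W) Z := rfl

theorem DT_Ric (U V W : 𝔛) :
    G.DT G.Ric U V W = ∑ i, G.g (G.DR U (G.e i) V W) (G.e i) := by
  have h := G.D_trace (G.curvForm V W) U
  simp only [curvForm_apply] at h
  rw [DT, Ric_apply, Ric_apply, Ric_apply, h, ← Finset.sum_sub_distrib, ← Finset.sum_sub_distrib]
  refine Finset.sum_congr rfl fun i _ ↦ ?_
  rw [g_DR]; ring

/-- The divergence of a bilinear form in its first argument. -/
def divT (T : 𝔛 →ₗ[A] 𝔛 →ₗ[A] A) (W : 𝔛) : A := ∑ i, G.DT T (G.e i) (G.e i) W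

/-- The contracted second Bianchi identity. -/
theorem D_S (U : 𝔛) : G.D U G.S = 2 * G.divT G.Ric U := by
  have h1 : G.D U G.S = ∑ j, ∑ i, G.g (G.DR U (G.e i) (G.e j) (G.e j)) (G.e i) := by
    rw [S, G.D_trace]
    exact Finset.sum_congr rfl fun j _ ↦ G.DT_Ric U (G.e j) (G.e j)
  have hs : G.divT G.Ric U = ∑ j, ∑ i, G.g (G.DR (G.e j) (G.e i) U (G.e j)) (G.e i) := by
    simp only [divT]
    refine Finset.sum_congr rfl fun j _ ↦ ?_
    rw [← G.DT_Ric]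
    simp only [DT, G.Ric_comm U, G.Ric_comm (G.N (G.e j) U)]
    ring
  -- The second Bianchi identity for `U, e i, e j`, before summation; after summing, the two terms
  -- on the right are the same double sum with indices exchanged.
  have key (i j : ι) : G.g (G.DR U (G.e i) (G.e j) (G.e j)) (G.e i)
      = G.g (G.DR (G.e i) (G.e j) U (G.e i)) (G.e j)
        + G.g (G.DR (G.e j) (G.e i) U (G.e j)) (G.e i) := by
    have h := congrArg (fun Y ↦ G.g Y (G.e i)) (G.bianchi_second U (G.e i) (G.e j) (G.e j))
    simp only [map_add, LinearMap.add_apply, map_zero, LinearMap.zero_apply] at h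
    rw [G.g_DR_skew (G.e i), G.DR_swap (G.e j) U, map_neg, LinearMap.neg_apply] at h
    linear_combination (exp := 1) h
  rw [h1, hs, two_mul]
  simp only [key, Finset.sum_add_distrib]
  rw [Finset.sum_comm]

/-! ### Divergences -/

/-- The divergence of a vector field. -/
def div (V : 𝔛) : A := ∑ i, G.g (G.N (G.e i) V) (G.e i)

/-- The gradient of a function. -/
def grad (f : A) : 𝔛 := ∑ i, G.D (G.e i) f • G.e i

theorem g_grad (f : A) (V : 𝔛) : G.g (G.grad f) V = G.D V f := by
  conv_rhs => rw [← G.sum_frame V]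
  let φ : 𝔛 →ₗ[A] A := ⟨⟨fun W ↦ G.D W f, by simp⟩, by simp⟩
  change _ = φ _
  rw [map_sum, grad, map_sum, LinearMap.sum_apply]
  refine Finset.sum_congr rfl fun i _ ↦ ?_
  rw [map_smul, map_smul, LinearMap.smul_apply, smul_eq_mul, smul_eq_mul, G.g_comm V, mul_comm]
  rfl

theorem div_grad (f : A) :
    G.div (G.grad f) = ∑ j, (G.D (G.e j) (G.D (G.e j) f) - G.D (G.N (G.e j) (G.e j)) f) := by
  refine Finset.sum_congr rfl fun j _ ↦ ?_
  rw [← G.g_grad f (G.e j), ← G.g_grad f (G.N _ _), metric]; ring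

/-- The bilinear form `(Y,Z) ↦ ⟨∇_Y X, Z⟩`. -/
def nabla (X : 𝔛) : 𝔛 →ₗ[A] 𝔛 →ₗ[A] A :=
  LinearMap.mk₂ A (fun Y Z ↦ G.g (G.N Y X) Z) (by simp) (by simp) (by simp) (by simp)

theorem nabla_apply (X Y Z : 𝔛) : G.nabla X Y Z = G.g (G.N Y X) Z := rfl

theorem D_div (X V : 𝔛) :
    G.D V (G.div X) = ∑ i, G.g (G.N V (G.N (G.e i) X) - G.N (G.N V (G.e i)) X) (G.e i) := by
  have h := G.D_trace (G.nabla X) V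
  simp only [nabla_apply] at h
  rw [div, h]
  refine Finset.sum_congr rfl fun i _ ↦ ?_
  rw [metric, map_sub, LinearMap.sub_apply]; ring

/-- Exchanging `∇_{e i}` and `∇_V` on `X` costs a curvature term, whose trace is Ricci. -/
theorem divT_flip_nabla (X V : 𝔛) :
    G.divT (G.nabla X).flip V = G.Ric V X + G.D V (G.div X) := by
  rw [D_div, Ric_apply, ← Finset.sum_add_distrib]
  refine Finset.sum_congr rfl fun i _ ↦ ?_
  simp only [DT, LinearMap.flip_apply, nabla_apply, metric, R_apply, map_sub,
    AddMonoidHom.sub_apply, LinearMap.sub_apply]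
  ring

theorem divT_g (V : 𝔛) : G.divT G.g V = 0 :=
  Finset.sum_eq_zero fun i _ ↦ by rw [DT, metric]; ring

theorem divT_add (T T' : 𝔛 →ₗ[A] 𝔛 →ₗ[A] A) (V : 𝔛) :
    G.divT (T + T') V = G.divT T V + G.divT T' V := by
  simp only [divT, DT, ← Finset.sum_add_distrib, LinearMap.add_apply, map_add]
  exact Finset.sum_congr rfl fun i _ ↦ by ring

theorem divT_smul (c : ℝ) (T : 𝔛 →ₗ[A] 𝔛 →ₗ[A] A) (V : 𝔛) :
    G.divT (algebraMap ℝ A c • T) V = algebraMap ℝ A c * G.divT T V := by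
  simp only [divT, DT, Finset.mul_sum, LinearMap.smul_apply, smul_eq_mul, Derivation.leibniz,
    Derivation.map_algebraMap]
  exact Finset.sum_congr rfl fun i _ ↦ by ring

/-- With `Z` frozen the covariant derivative is tensorial in the remaining slots, so that `D_trace`
can be applied to it in `div_divT`. -/
theorem DT_bilinear (T : 𝔛 →ₗ[A] 𝔛 →ₗ[A] A) (Z : 𝔛) :
    ∃ B : 𝔛 →ₗ[A] 𝔛 →ₗ[A] A, ∀ V Y, B V Y = G.DT T V Y Z := by
  refine ⟨LinearMap.mk₂ A (fun V Y ↦ G.DT T V Y Z) ?_ ?_ ?_ ?_, fun V Y ↦ rfl⟩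
  · intro V V' Y
    simp only [DT, map_add, AddMonoidHom.add_apply, LinearMap.add_apply, Derivation.add_apply]
    ring
  · intro f V Y
    simp only [DT, map_smul, AddMonoidHom.smul_apply, LinearMap.smul_apply, Derivation.smul_apply,
      smul_eq_mul]
    ring
  · intro V Y Y'
    simp only [DT, map_add, LinearMap.add_apply]
    ring
  · intro f V Y
    simp only [DT, map_smul, leibniz, map_add, LinearMap.add_apply, LinearMap.smul_apply,
      smul_eq_mul, Derivation.leibniz]
    ring

/-! ### Second covariant derivatives and double divergences. -/

/-- The second covariant derivative `(∇²_{U,V} T)(Y,Z)` of a bilinear form. -/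
def D2T (T : 𝔛 →ₗ[A] 𝔛 →ₗ[A] A) (U V Y Z : 𝔛) : A :=
  G.D U (G.DT T V Y Z) - G.DT T (G.N U V) Y Z - G.DT T V (G.N U Y) Z - G.DT T V Y (G.N U Z)

/-- The Ricci identity: vanishing torsion removes the first derivatives of `T`, and `D_comm` the
second derivatives of the function `T Y Z`. -/
theorem D2T_comm (T : 𝔛 →ₗ[A] 𝔛 →ₗ[A] A) (U V Y Z : 𝔛) :
    G.D2T T U V Y Z - G.D2T T V U Y Z = -T (G.R U V Y) Z - T Y (G.R U V Z) := by
  have h := G.D_comm U V (T Y Z)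
  simp only [D2T, DT, R_apply, map_sub, AddMonoidHom.sub_apply, LinearMap.sub_apply,
    Derivation.sub_apply] at h ⊢
  linear_combination (exp := 1) h

/-- The left side is the divergence of the one-form `divT T`; `D_trace` moves the outer derivative
inside the inner contraction. -/
theorem div_divT (T : 𝔛 →ₗ[A] 𝔛 →ₗ[A] A) :
    ∑ j, (G.D (G.e j) (G.divT T (G.e j)) - G.divT T (G.N (G.e j) (G.e j)))
      = ∑ j, ∑ i, G.D2T T (G.e j) (G.e i) (G.e i) (G.e j) := by
  refine Finset.sum_congr rfl fun j _ ↦ ?_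
  obtain ⟨B, hB⟩ := G.DT_bilinear T (G.e j)
  have h := G.D_trace B (G.e j)
  simp only [hB] at h
  rw [divT, h, divT, ← Finset.sum_sub_distrib]
  rfl

/-- The Ricci contraction of the curvature acting on a bilinear form. -/
theorem sum_R_apply (T : 𝔛 →ₗ[A] 𝔛 →ₗ[A] A) :
    ∑ j, ∑ i, T (G.R (G.e j) (G.e i) (G.e i)) (G.e j)
      = ∑ j, ∑ k, G.Ric (G.e k) (G.e j) * T (G.e k) (G.e j) := by
  refine Finset.sum_congr rfl fun j _ ↦ ?_
  have h (i : ι) : T (G.R (G.e j) (G.e i) (G.e i)) (G.e j)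
      = ∑ k, G.g (G.R (G.e i) (G.e k) (G.e j)) (G.e i) * T (G.e k) (G.e j) := by
    conv_lhs => rw [← G.sum_frame (G.R (G.e j) (G.e i) (G.e i))]
    simp only [map_sum, LinearMap.sum_apply, map_smul, LinearMap.smul_apply, smul_eq_mul]
    exact Finset.sum_congr rfl fun k _ ↦ by rw [g_R_pair]
  simp only [h, Ric_apply, Finset.sum_mul]
  exact Finset.sum_comm

/-- The double divergence of a skew-symmetric form vanishes. -/
theorem div_divT_eq_zero (T : 𝔛 →ₗ[A] 𝔛 →ₗ[A] A) (hT : ∀ Y Z, T Y Z = -T Z Y) :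
    ∑ j, (G.D (G.e j) (G.divT T (G.e j)) - G.divT T (G.N (G.e j) (G.e j))) = 0 := by
  rw [div_divT]
  have hDT (U Y Z : 𝔛) : G.DT T U Y Z = -G.DT T U Z Y := by
    simp only [DT]; rw [hT Y Z, hT (G.N U Y), hT Y, map_neg]; ring
  have hD2 (U V Y Z : 𝔛) : G.D2T T U V Y Z = -G.D2T T U V Z Y := by
    simp only [D2T]; rw [hDT V Y Z, hDT (G.N U V), hDT V (G.N U Y), hDT V Y, map_neg]; ring
  -- This is the full contraction of the symmetric Ricci tensor with a skew form.
  have hzero : ∑ j, ∑ i, T (G.R (G.e j) (G.e i) (G.e i)) (G.e j) = 0 := by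
    rw [sum_R_apply]
    apply eq_of_two_mul_eq
    rw [two_mul, mul_zero]
    nth_rw 2 [Finset.sum_comm]
    simp only [← Finset.sum_add_distrib]
    refine Finset.sum_eq_zero fun j _ ↦ Finset.sum_eq_zero fun k _ ↦ ?_
    rw [hT (G.e k), G.Ric_comm (G.e k)]; ring
  apply eq_of_two_mul_eq
  -- Skewness turns the sum of a term and its index exchange into a commutator of second
  -- derivatives, hence into curvature.
  have hcomm (j i : ι) : G.D2T T (G.e j) (G.e i) (G.e i) (G.e j)
      + G.D2T T (G.e i) (G.e j) (G.e j) (G.e i)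
      = -T (G.R (G.e j) (G.e i) (G.e i)) (G.e j) - T (G.R (G.e i) (G.e j) (G.e j)) (G.e i) := by
    have h := G.D2T_comm T (G.e j) (G.e i) (G.e i) (G.e j)
    rw [hD2 (G.e i) (G.e j) (G.e i), hT (G.e i), G.R_swap (G.e j) (G.e i) (G.e j), map_neg,
      LinearMap.neg_apply] at h
    linear_combination (exp := 1) h
  have hsum : ∑ j, ∑ i, G.D2T T (G.e j) (G.e i) (G.e i) (G.e j)
      + ∑ j, ∑ i, G.D2T T (G.e i) (G.e j) (G.e j) (G.e i) = 0 := by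
    simp only [← Finset.sum_add_distrib, hcomm]
    simp only [Finset.sum_sub_distrib, Finset.sum_neg_distrib]
    rw [Finset.sum_comm (f := fun j i ↦ T (G.R (G.e i) (G.e j) (G.e j)) (G.e i)), hzero]; simp
  rw [mul_zero, two_mul]
  nth_rw 2 [Finset.sum_comm]
  exact hsum

/-- The Laplacian of the scalar curvature of a Ricci soliton. -/
theorem div_grad_S (X : 𝔛) (lam : ℝ)
    (hX : ∀ U V, 2 * G.Ric U V + (G.g (G.N U X) V + G.g (G.N V X) U)
      = 2 * algebraMap ℝ A lam * G.g U V) :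
    G.div (G.grad G.S) = G.D X G.S + 2 * algebraMap ℝ A lam * G.S
      - 2 * ∑ i, ∑ j, G.Ric (G.e i) (G.e j) ^ 2 := by
  -- The trace of the soliton equation; `g (e i) (e i)` need only have zero derivative, its value is
  -- irrelevant.
  have hdiv (V : 𝔛) : G.D V (G.div X) = -G.D V G.S := by
    have h : 2 * (G.S + G.div X) = 2 * (algebraMap ℝ A lam * ∑ i, G.g (G.e i) (G.e i)) := by
      rw [S, div, ← Finset.sum_add_distrib, Finset.mul_sum, Finset.mul_sum, Finset.mul_sum]
      exact Finset.sum_congr rfl fun i _ ↦ by linear_combination (exp := 1) hX (G.e i) (G.e i)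
    have h' := congrArg (G.D V) (eq_of_two_mul_eq h)
    simp only [map_add, Derivation.leibniz, map_sum, G.D_frame, Derivation.map_algebraMap,
      Finset.sum_const_zero, smul_zero, add_zero] at h'
    linear_combination (exp := 1) h'
  have hform : G.nabla X + (G.nabla X).flip + algebraMap ℝ A 2 • G.Ric
      = algebraMap ℝ A (2 * lam) • G.g := by
    ext U V
    have h := hX U V
    simp only [LinearMap.add_apply, LinearMap.flip_apply, nabla_apply, LinearMap.smul_apply,
      smul_eq_mul, map_mul, map_ofNat]
    linear_combination (exp := 1) h
  -- The divergence of the soliton equation: `2 div Ric` and `d(div X)` cancel.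
  have hnabla (V : 𝔛) : G.divT (G.nabla X) V = -G.Ric V X := by
    have h := congrArg (fun T ↦ G.divT T V) hform
    simp only [divT_add, divT_smul, divT_g, divT_flip_nabla, hdiv] at h
    rw [map_ofNat, ← G.D_S V] at h
    linear_combination (exp := 1) h
  have hskew (V : 𝔛) : G.divT (G.nabla X + algebraMap ℝ A (-1) • (G.nabla X).flip) V
      = G.D V G.S - 2 * G.Ric V X := by
    rw [divT_add, divT_smul, divT_flip_nabla, hnabla, hdiv, map_neg, map_one]; ring
  have h0 := G.div_divT_eq_zero (G.nabla X + algebraMap ℝ A (-1) • (G.nabla X).flip)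
    fun Y Z ↦ by simp
  have hRic : ∑ j, (G.D (G.e j) (G.Ric (G.e j) X) - G.Ric (G.N (G.e j) (G.e j)) X)
      = G.divT G.Ric X + ∑ j, G.Ric (G.e j) (G.N (G.e j) X) := by
    rw [divT, ← Finset.sum_add_distrib]
    exact Finset.sum_congr rfl fun j _ ↦ by rw [DT]; ring
  have hexp (j : ι) : G.Ric (G.e j) (G.N (G.e j) X)
      = ∑ k, G.g (G.N (G.e j) X) (G.e k) * G.Ric (G.e j) (G.e k) := by
    conv_lhs => rw [← G.sum_frame (G.N (G.e j) X)]
    simp [map_sum]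
  have hS : G.S = ∑ j, ∑ k, G.g (G.e j) (G.e k) * G.Ric (G.e j) (G.e k) := by
    refine Finset.sum_congr rfl fun j _ ↦ ?_
    conv_lhs => arg 2; rw [← G.sum_frame (G.e j)]
    simp [map_sum]
  -- Symmetry of Ricci allows `∇X` to be replaced by its symmetric part, which `hX` provides.
  have hpair : 2 * ∑ j, G.Ric (G.e j) (G.N (G.e j) X)
      = 2 * algebraMap ℝ A lam * G.S - 2 * ∑ i, ∑ j, G.Ric (G.e i) (G.e j) ^ 2 := by
    simp only [hexp]
    rw [two_mul]
    nth_rw 2 [Finset.sum_comm]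
    rw [hS]
    simp only [Finset.mul_sum, ← Finset.sum_add_distrib, ← Finset.sum_sub_distrib]
    refine Finset.sum_congr rfl fun j _ ↦ Finset.sum_congr rfl fun k _ ↦ ?_
    rw [G.Ric_comm (G.e k) (G.e j)]
    linear_combination (exp := 1) G.Ric (G.e j) (G.e k) * hX (G.e j) (G.e k)
  -- The vanishing double divergence of the skew form, with `hskew` substituted for its first
  -- divergence.
  have h1 : G.div (G.grad G.S)
      = 2 * ∑ j, (G.D (G.e j) (G.Ric (G.e j) X) - G.Ric (G.N (G.e j) (G.e j)) X) := by
    rw [div_grad, ← sub_eq_zero, ← h0, Finset.mul_sum, ← Finset.sum_sub_distrib]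
    refine Finset.sum_congr rfl fun j _ ↦ ?_
    rw [hskew, hskew, map_sub, two_mul, two_mul, map_add]; ring
  rw [h1, hRic, mul_add, hpair, ← D_S]; ring

end FramedGeometry

/-! ### Smooth local orthonormal frames. -/

namespace Riem

variable {E : Type*} [NormedAddCommGroup E] [NormedSpace ℝ E] [FiniteDimensional ℝ E]
  {H : Type*} [TopologicalSpace H] {I : ModelWithCorners ℝ E H}
  {M : Type*} [TopologicalSpace M] [ChartedSpace H M] [IsManifold I ∞ M]
  [RiemannianBundle (fun x : M ↦ TangentSpace I x)]
  [IsContMDiffRiemannianBundle I ∞ E (fun x : M ↦ TangentSpace I x)]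

theorem contMDiffOn_inner {Y Z : Π x : M, TangentSpace I x} {s : Set M}
    (hY : CMDiff[s] ∞ (T% Y)) (hZ : CMDiff[s] ∞ (T% Z)) :
    CMDiff[s] ∞ (fun y ↦ inner ℝ (Y y) (Z y)) :=
  ContMDiffOn.inner_bundle (F := E) (E := fun x : M ↦ TangentSpace I x) (b := id) hY hZ

/-- Strong induction on the index: each projection is a quotient of smooth functions whose
denominator is nonzero by linear independence. -/
theorem contMDiffOn_gramSchmidt {n : ℕ} {f : Fin n → Π x : M, TangentSpace I x} {s : Set M}
    (hf : ∀ i, CMDiff[s] ∞ (T% (f i))) (hli : ∀ x ∈ s, LinearIndependent ℝ (f · x)) (i : Fin n) :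
    CMDiff[s] ∞ (T% (fun x ↦ InnerProductSpace.gramSchmidt ℝ (f · x) i)) := by
  induction i using WellFoundedLT.induction with
  | _ i ih =>
  simp only [InnerProductSpace.gramSchmidt_def ℝ _ i, Submodule.starProjection_singleton,
    ← real_inner_self_eq_norm_sq]
  refine (hf i).sub_section (.sum_section fun j hj ↦ ?_)
  have hj' := ih j (Finset.mem_Iio.1 hj)
  refine ContMDiffOn.smul_section (ContMDiffOn.div₀ (contMDiffOn_inner hj' (hf i))
    (contMDiffOn_inner hj' hj') fun x hx ↦ ?_) hj'
  exact inner_self_ne_zero.2 (InnerProductSpace.gramSchmidt_ne_zero j (hli x hx))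

/-- A smooth orthonormal frame of vector fields over an open set, extended by zero. -/
structure IsOrthonormalFrame (s : Set M)
    (e : Fin (Module.finrank ℝ E) → Π x : M, TangentSpace I x) : Prop where
  isOpen : IsOpen s
  contMDiffOn : ∀ i, CMDiff[s] ∞ (T% (e i))
  orthonormal : ∀ x ∈ s, Orthonormal ℝ (fun i ↦ e i x)
  eq_zero : ∀ i, ∀ x ∉ s, e i x = 0

open scoped Classical in
/-- The restriction of a vector field to a set, extended by zero. -/
noncomputable def restrictField (s : Set M) (V : Π x : M, TangentSpace I x) (x : M) :
    TangentSpace I x :=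
  if x ∈ s then V x else 0

theorem restrictField_of_mem {s : Set M} (V : Π x : M, TangentSpace I x) {x : M} (hx : x ∈ s) :
    restrictField s V x = V x := if_pos hx

theorem restrictField_of_notMem {s : Set M} (V : Π x : M, TangentSpace I x) {x : M} (hx : x ∉ s) :
    restrictField s V x = 0 := if_neg hx

theorem contMDiffOn_restrictField {s : Set M} {V : Π x : M, TangentSpace I x}
    (hV : CMDiff[s] ∞ (T% V)) : CMDiff[s] ∞ (T% (restrictField s V)) :=
  hV.congr fun x hx ↦ by rw [restrictField_of_mem V hx]

theorem exists_isOrthonormalFrame {u : Set M} (hu : IsOpen u) {x₀ : M} (hx₀ : x₀ ∈ u) :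
    ∃ s ⊆ u, ∃ e : Fin (Module.finrank ℝ E) → Π x : M, TangentSpace I x,
      x₀ ∈ s ∧ IsOrthonormalFrame s e := by
  set t := trivializationAt E (TangentSpace I) x₀
  set b := Module.finBasis ℝ E
  have hF := t.isLocalFrameOn_localFrame_baseSet I ∞ b
  have hsm := contMDiffOn_gramSchmidt hF.contMDiffOn (fun x hx ↦ hF.linearIndependent hx)
  have hsub : t.baseSet ∩ u ⊆ t.baseSet := Set.inter_subset_left
  refine ⟨t.baseSet ∩ u, Set.inter_subset_right, fun i ↦ restrictField (t.baseSet ∩ u) fun x ↦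
    InnerProductSpace.gramSchmidtNormed ℝ (t.localFrame b · x) i,
    ⟨FiberBundle.mem_baseSet_trivializationAt' x₀, hx₀⟩, t.open_baseSet.inter hu, fun i ↦
    contMDiffOn_restrictField (ContMDiffOn.mono (s := t.baseSet) ?_ hsub), fun x hx ↦ ?_, fun i x hx ↦
    restrictField_of_notMem _ hx⟩
  swap
  · simp only [restrictField_of_mem _ hx]
    exact InnerProductSpace.gramSchmidtNormed_orthonormal (hF.linearIndependent hx.1)
  have hinner := contMDiffOn_inner (hsm i) (hsm i)
  refine ContMDiffOn.smul_section (ContMDiffOn.inv₀ ?_ fun x hx ↦ ?_) (hsm i)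
  · simp only [norm_eq_sqrt_real_inner]
    intro x hx
    refine ContMDiffAt.comp_contMDiffWithinAt x (g := Real.sqrt)
      (Real.contDiffAt_sqrt ?_).contMDiffAt (hinner x hx)
    exact inner_self_ne_zero.2
      (InnerProductSpace.gramSchmidt_ne_zero i (hF.linearIndependent hx))
  · exact norm_ne_zero_iff.2 (InnerProductSpace.gramSchmidt_ne_zero i (hF.linearIndependent hx))

variable {s : Set M} {e : Fin (Module.finrank ℝ E) → Π x : M, TangentSpace I x}

theorem IsOrthonormalFrame.exists_basis (he : IsOrthonormalFrame s e) {x : M} (hx : x ∈ s) :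
    ∃ b : OrthonormalBasis (Fin (Module.finrank ℝ E)) ℝ (TangentSpace I x), ∀ i, b i = e i x := by
  have ho := he.orthonormal x hx
  have hsp := ho.linearIndependent.span_eq_top_of_card_eq_finrank'
    (Fintype.card_fin _ : _ = Module.finrank ℝ E)
  exact ⟨OrthonormalBasis.mk ho hsp.ge, fun i ↦ by rw [OrthonormalBasis.coe_mk]⟩

theorem IsOrthonormalFrame.sum_inner_smul (he : IsOrthonormalFrame s e) {x : M} (hx : x ∈ s)
    (v : TangentSpace I x) : ∑ i, (inner ℝ v (e i x) : ℝ) • e i x = v := by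
  obtain ⟨b, hb⟩ := he.exists_basis hx
  simpa only [hb, real_inner_comm] using b.sum_repr' v

theorem IsOrthonormalFrame.contMDiffOn_of_inner (he : IsOrthonormalFrame s e)
    {Y : Π x : M, TangentSpace I x} (hY : ∀ i, CMDiff[s] ∞ (fun y ↦ inner ℝ (Y y) (e i y))) :
    CMDiff[s] ∞ (T% Y) := by
  have h : CMDiff[s] ∞ (T% (fun y ↦ ∑ i, (inner ℝ (Y y) (e i y) : ℝ) • e i y)) :=
    .sum_section fun i _ ↦ (hY i).smul_section (he.contMDiffOn i)
  exact h.congr fun y hy ↦ by rw [he.sum_inner_smul hy]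

/-! ### Smoothness and commutation of derivatives on a frame domain. -/

theorem contMDiffOn_mlieBracket (hs : IsOpen s) {U V : Π x : M, TangentSpace I x}
    (hU : CMDiff[s] ∞ (T% U)) (hV : CMDiff[s] ∞ (T% V)) :
    CMDiff[s] ∞ (T% (mlieBracket I U V)) := by
  intro x hx
  have : IsManifold I (minSmoothness ℝ 2) M := by
    rw [minSmoothness_of_isRCLikeNormedField]; infer_instance
  have : IsManifold I (((⊤ : ℕ∞) : ℕ∞ω) + 1) M := by simpa using ‹IsManifold I ∞ M›
  exact (ContMDiffAt.mlieBracket_vectorField (m := ⊤) (n := ⊤) (hU.contMDiffAt (hs.mem_nhds hx))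
    (hV.contMDiffAt (hs.mem_nhds hx)) (by simp)).contMDiffWithinAt

theorem mdiffAt_of_contMDiffOn (hs : IsOpen s) {U : Π x : M, TangentSpace I x}
    (hU : CMDiff[s] ∞ (T% U)) {x : M} (hx : x ∈ s) : MDiffAt (T% U) x :=
  (hU.contMDiffAt (hs.mem_nhds hx)).mdifferentiableAt (by simp)

theorem mdiffAt_fun_of_contMDiffOn (hs : IsOpen s) {f : M → ℝ}
    (hf : CMDiff[s] ∞ f) {x : M} (hx : x ∈ s) : MDiffAt f x :=
  (hf.contMDiffAt (hs.mem_nhds hx)).mdifferentiableAt (by simp)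

theorem subsingleton_tangentSpace [IsEmpty (Fin (Module.finrank ℝ E))] (x : M) :
    Subsingleton (TangentSpace I x) := by
  have h : Module.finrank ℝ E = 0 := by
    by_contra h; exact IsEmpty.false (⟨0, Nat.pos_of_ne_zero h⟩ : Fin (Module.finrank ℝ E))
  exact (Module.finrank_zero_iff.1 h : Subsingleton E)

/-- Smoothness is inherited from the bracket: `[V, f W] - f [V, W] = (V f) W`, paired with a unit
frame field `W`. In dimension zero there is no `W`, but then `V = 0`. -/
theorem IsOrthonormalFrame.contMDiffOn_mvfderiv (he : IsOrthonormalFrame s e) {f : M → ℝ}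
    {V : Π x : M, TangentSpace I x} (hf : CMDiff[s] ∞ f) (hV : CMDiff[s] ∞ (T% V)) :
    CMDiff[s] ∞ (fun y ↦ mvfderiv I f y (V y)) := by
  rcases isEmpty_or_nonempty (Fin (Module.finrank ℝ E)) with h | ⟨⟨i⟩⟩
  · have h0 (y : M) : V y = 0 := (subsingleton_tangentSpace y).elim _ _
    simpa [h0] using contMDiffOn_const
  · have hi := he.contMDiffOn i
    have h := contMDiffOn_inner ((contMDiffOn_mlieBracket he.isOpen hV
      (hf.smul_section hi)).sub_section (hf.smul_section
        (contMDiffOn_mlieBracket he.isOpen hV hi))) hi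
    refine h.congr fun y hy ↦ ?_
    have h1 := mlieBracket_smul_right (V := V) (mdiffAt_fun_of_contMDiffOn he.isOpen hf hy)
      (mdiffAt_of_contMDiffOn he.isOpen hi hy)
    simp only [Pi.sub_apply, Pi.smul_apply', h1, add_sub_cancel_right, inner_smul_left]
    rw [real_inner_self_eq_norm_sq, (he.orthonormal y hy).1 i]
    simp

/-- The frame coefficients of `∇_U V` are half the Koszul expressions, each term of which is smooth.
-/
theorem IsOrthonormalFrame.contMDiffOn_leviCivita (he : IsOrthonormalFrame s e)
    {U V : Π x : M, TangentSpace I x} (hU : CMDiff[s] ∞ (T% U)) (hV : CMDiff[s] ∞ (T% V)) :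
    CMDiff[s] ∞ (T% (fun y ↦ leviCivita I M V y (U y))) := by
  refine he.contMDiffOn_of_inner fun i ↦ ?_
  have hi := he.contMDiffOn i
  have hk : CMDiff[s] ∞ (fun y ↦ koszul V U (e i) y) := by
    refine (((((he.contMDiffOn_mvfderiv (contMDiffOn_inner hV hi) hU).add
      (he.contMDiffOn_mvfderiv (contMDiffOn_inner hi hU) hV)).sub
      (he.contMDiffOn_mvfderiv (contMDiffOn_inner hU hV) hi)).add
      (contMDiffOn_inner (contMDiffOn_mlieBracket he.isOpen hU hV) hi)).sub
      (contMDiffOn_inner (contMDiffOn_mlieBracket he.isOpen hV hi) hU)).add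
      (contMDiffOn_inner (contMDiffOn_mlieBracket he.isOpen hi hU) hV)
  refine ((contMDiffOn_const (c := (1 / 2 : ℝ))).mul hk).congr fun y hy ↦ ?_
  have h := two_mul_inner_leviCivitaFun (mdiffAt_of_contMDiffOn he.isOpen hV hy)
    (mdiffAt_of_contMDiffOn he.isOpen hU hy) (mdiffAt_of_contMDiffOn he.isOpen hi hy)
  change inner ℝ (leviCivitaFun V y (U y)) (e i y) = _
  simp only [Pi.mul_apply, ← h]
  ring

theorem mlieBracket_jacobi (hs : IsOpen s) {U V W : Π x : M, TangentSpace I x}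
    (hU : CMDiff[s] ∞ (T% U)) (hV : CMDiff[s] ∞ (T% V)) (hW : CMDiff[s] ∞ (T% W)) {x : M}
    (hx : x ∈ s) :
    mlieBracket I U (mlieBracket I V W) x =
      mlieBracket I (mlieBracket I U V) W x + mlieBracket I V (mlieBracket I U W) x := by
  have : IsManifold I (minSmoothness ℝ 3) M := by
    rw [minSmoothness_of_isRCLikeNormedField]; infer_instance
  have h2 : minSmoothness ℝ 2 ≤ ∞ := by
    rw [minSmoothness_of_isRCLikeNormedField]; norm_cast
  exact leibniz_identity_mlieBracket_apply
    ((hU.contMDiffAt (hs.mem_nhds hx)).of_le h2)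
    ((hV.contMDiffAt (hs.mem_nhds hx)).of_le h2) ((hW.contMDiffAt (hs.mem_nhds hx)).of_le h2)

theorem mlieBracket_congr (hs : IsOpen s) {U U' V V' : Π x : M, TangentSpace I x} {x : M}
    (hx : x ∈ s) (hU : ∀ y ∈ s, U y = U' y) (hV : ∀ y ∈ s, V y = V' y) :
    mlieBracket I U V x = mlieBracket I U' V' x :=
  Filter.EventuallyEq.mlieBracket_vectorField_eq
    (Filter.eventually_of_mem (hs.mem_nhds hx) hU) (Filter.eventually_of_mem (hs.mem_nhds hx) hV)

/-- Expand the Jacobi identity for `U`, `V`, `f W` with `W` a frame field and subtract `f` times the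
one for `U`, `V`, `W`: what remains is the claim times `W x ≠ 0`. -/
theorem IsOrthonormalFrame.mvfderiv_comm (he : IsOrthonormalFrame s e) {f : M → ℝ}
    {U V : Π x : M, TangentSpace I x} (hf : CMDiff[s] ∞ f) (hU : CMDiff[s] ∞ (T% U))
    (hV : CMDiff[s] ∞ (T% V)) {x : M} (hx : x ∈ s) :
    mvfderiv I (fun y ↦ mvfderiv I f y (V y)) x (U x)
      - mvfderiv I (fun y ↦ mvfderiv I f y (U y)) x (V x)
      = mvfderiv I f x (mlieBracket I U V x) := by
  rcases isEmpty_or_nonempty (Fin (Module.finrank ℝ E)) with h | ⟨⟨i⟩⟩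
  · have h0 (v : TangentSpace I x) : v = 0 := (subsingleton_tangentSpace x).elim _ _
    rw [h0 (U x), h0 (V x), h0 (mlieBracket I U V x)]
    simp
  · have hs := he.isOpen
    have hW := he.contMDiffOn i
    have hne : e i x ≠ 0 := (he.orthonormal x hx).ne_zero i
    set W := e i
    have d1 {y} (hy : y ∈ s) := mdiffAt_fun_of_contMDiffOn hs hf hy
    have dW {y} (hy : y ∈ s) := mdiffAt_of_contMDiffOn hs hW hy
    have key {U V : Π x : M, TangentSpace I x} (hU : CMDiff[s] ∞ (T% U))
        (hV : CMDiff[s] ∞ (T% V)) :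
        mlieBracket I U (mlieBracket I V (f • W)) x
          = mvfderiv I (fun y ↦ mvfderiv I f y (V y)) x (U x) • W x
            + mvfderiv I f x (V x) • mlieBracket I U W x
            + (mvfderiv I f x (U x) • mlieBracket I V W x
            + f x • mlieBracket I U (mlieBracket I V W) x) := by
      have hVf := he.contMDiffOn_mvfderiv hf hV
      have hVW := contMDiffOn_mlieBracket hs hV hW
      rw [mlieBracket_congr hs (U' := U)
        (V' := (fun y ↦ mvfderiv I f y (V y)) • W + f • mlieBracket I V W) hx (fun _ _ ↦ rfl)
        (fun y hy ↦ mlieBracket_smul_right (d1 hy) (dW hy)),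
        mlieBracket_add_right (mdiffAt_of_contMDiffOn hs (hVf.smul_section hW) hx)
          (mdiffAt_of_contMDiffOn hs (hf.smul_section hVW) hx),
        mlieBracket_smul_right (mdiffAt_fun_of_contMDiffOn hs hVf hx) (dW hx),
        mlieBracket_smul_right (d1 hx) (mdiffAt_of_contMDiffOn hs hVW hx)]
    have hj := mlieBracket_jacobi hs hU hV (hf.smul_section hW) hx
    rw [key hU hV, key hV hU, mlieBracket_smul_right (d1 hx) (dW hx),
      mlieBracket_jacobi hs hU hV hW hx] at hj
    refine smul_left_injective ℝ hne ?_
    rw [← sub_eq_zero] at hj ⊢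
    rw [← hj]
    module

/-! ### The algebraic model over a frame domain. -/

variable (I) in
/-- The functions on `M` that are smooth on `s`. -/
noncomputable def smoothOn (s : Set M) : Subalgebra ℝ (M → ℝ) where
  carrier := {f | CMDiff[s] ∞ f}
  mul_mem' hf hg := ContMDiffOn.mul hf hg
  add_mem' hf hg := ContMDiffOn.add hf hg
  algebraMap_mem' _ := contMDiffOn_const

variable (I) in
/-- The vector fields that are smooth on `s` and vanish outside `s`. -/
noncomputable def fieldsOn (s : Set M) : Submodule (smoothOn I s) (Π x : M, TangentSpace I x) where
  carrier := {V | CMDiff[s] ∞ (T% V) ∧ ∀ x ∉ s, V x = 0}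
  add_mem' hU hV := ⟨hU.1.add_section hV.1, fun x hx ↦ by simp [hU.2 x hx, hV.2 x hx]⟩
  zero_mem' := ⟨(contMDiff_zeroSection ℝ (TangentSpace I (M := M))).contMDiffOn, fun _ _ ↦ rfl⟩
  smul_mem' f V hV := ⟨ContMDiffOn.smul_section f.2 hV.1, fun x hx ↦ by
    change (f : M → ℝ) x • V x = 0
    rw [hV.2 x hx, smul_zero]⟩

noncomputable instance smoothOn.commRing : CommRing (smoothOn I s) := (smoothOn I s).toCommRing

noncomputable instance smoothOn.algebra : Algebra ℝ (smoothOn I s) := (smoothOn I s).algebra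

noncomputable instance fieldsOn.addCommGroup : AddCommGroup (fieldsOn I s) :=
  (fieldsOn I s).addCommGroup

noncomputable instance fieldsOn.module : Module (smoothOn I s) (fieldsOn I s) :=
  (fieldsOn I s).module

noncomputable instance fieldsOn.smul : SMul (smoothOn I s) (fieldsOn I s) :=
  fieldsOn.module.toSMul

/-- The derivative of functions along a vector field, as a derivation. -/
noncomputable def IsOrthonormalFrame.deriv (he : IsOrthonormalFrame s e) (V : fieldsOn I s) :
    Derivation ℝ (smoothOn I s) (smoothOn I s) :=
  Derivation.mk'
    { toFun := fun f ↦ ⟨fun y ↦ mvfderiv I f.1 y (V.1 y), he.contMDiffOn_mvfderiv f.2 V.2.1⟩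
      map_add' := fun f g ↦ by
        ext y
        by_cases hy : y ∈ s
        · change mvfderiv I (f.1 + g.1) y (V.1 y) = _
          rw [mvfderiv_add (mdiffAt_fun_of_contMDiffOn he.isOpen f.2 hy)
            (mdiffAt_fun_of_contMDiffOn he.isOpen g.2 hy)]
          rfl
        -- Off `s` the functions need not be differentiable, but both sides vanish because `V` does.
        · simp [V.2.2 y hy]
      map_smul' := fun c f ↦ by
        ext y
        by_cases hy : y ∈ s
        · change mvfderiv I ((fun _ ↦ c) * f.1) y (V.1 y) = _
          rw [mvfderiv_mul mdifferentiableAt_const (mdiffAt_fun_of_contMDiffOn he.isOpen f.2 hy)]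
          simp [mvfderiv_const]
        · simp [V.2.2 y hy] }
    fun f g ↦ by
      ext y
      by_cases hy : y ∈ s
      · change mvfderiv I (f.1 * g.1) y (V.1 y) = _
        rw [mvfderiv_mul (mdiffAt_fun_of_contMDiffOn he.isOpen f.2 hy)
          (mdiffAt_fun_of_contMDiffOn he.isOpen g.2 hy)]
        simp
      · simp [V.2.2 y hy]

/-- The Levi-Civita connection on `fieldsOn I s`. -/
noncomputable def IsOrthonormalFrame.conn (he : IsOrthonormalFrame s e) (U : fieldsOn I s) :
    fieldsOn I s →+ fieldsOn I s where
  toFun V := ⟨fun y ↦ leviCivita I M V.1 y (U.1 y), he.contMDiffOn_leviCivita U.2.1 V.2.1,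
    fun y hy ↦ by beta_reduce; rw [U.2.2 y hy, map_zero]⟩
  map_zero' := by
    ext y
    by_cases hy : y ∈ s
    · change leviCivitaFun 0 y (U.1 y) = 0
      rw [isCovariantDerivativeOn_leviCivitaFun.zero]; rfl
    · change leviCivitaFun 0 y (U.1 y) = 0
      rw [U.2.2 y hy, map_zero]
  map_add' V V' := by
    ext y
    change leviCivitaFun (V.1 + V'.1) y (U.1 y)
      = leviCivitaFun V.1 y (U.1 y) + leviCivitaFun V'.1 y (U.1 y)
    by_cases hy : y ∈ s
    · rw [isCovariantDerivativeOn_leviCivitaFun.add (mdiffAt_of_contMDiffOn he.isOpen V.2.1 hy)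
        (mdiffAt_of_contMDiffOn he.isOpen V'.2.1 hy)]
      rfl
    · simp [U.2.2 y hy]

variable (I s) in
/-- The metric as a bilinear form on `fieldsOn I s`. -/
noncomputable def metricOn :
    fieldsOn I s →ₗ[smoothOn I s] fieldsOn I s →ₗ[smoothOn I s] smoothOn I s :=
  LinearMap.mk₂ (smoothOn I s)
    (fun U V ↦ ⟨fun y ↦ inner ℝ (U.1 y) (V.1 y), contMDiffOn_inner U.2.1 V.2.1⟩)
    (fun U U' V ↦ by ext y; exact inner_add_left (U.1 y) (U'.1 y) (V.1 y))
    (fun f U V ↦ by ext y; exact real_inner_smul_left (U.1 y) (V.1 y) (f.1 y))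
    (fun U V V' ↦ by ext y; exact inner_add_right (U.1 y) (V.1 y) (V'.1 y))
    (fun f U V ↦ by ext y; exact real_inner_smul_right (U.1 y) (V.1 y) (f.1 y))

theorem mlieBracket_eq_sub (hs : IsOpen s) {U V : Π x : M, TangentSpace I x}
    (hU : CMDiff[s] ∞ (T% U)) (hV : CMDiff[s] ∞ (T% V)) {y : M} (hy : y ∈ s) :
    mlieBracket I U V y = leviCivita I M V y (U y) - leviCivita I M U y (V y) :=
  ((CovariantDerivative.torsion_eq_zero_iff _).1 leviCivita_torsion
    (mdiffAt_of_contMDiffOn hs hU hy) (mdiffAt_of_contMDiffOn hs hV hy)).symm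

theorem leviCivita_congr (hs : IsOpen s) {U V : Π x : M, TangentSpace I x}
    (hU : CMDiff[s] ∞ (T% U)) (hV : CMDiff[s] ∞ (T% V)) (h : ∀ y ∈ s, U y = V y) {y : M}
    (hy : y ∈ s) : leviCivita I M U y = leviCivita I M V y :=
  isCovariantDerivativeOn_leviCivitaFun.congr_of_eventuallyEq
    (mdiffAt_of_contMDiffOn hs hU hy) (mdiffAt_of_contMDiffOn hs hV hy) Filter.univ_mem
    (Filter.eventually_of_mem (hs.mem_nhds hy) h)

theorem mvfderiv_congr {f g : M → ℝ} {y : M} (h : f =ᶠ[𝓝 y] g) :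
    mvfderiv I f y = mvfderiv I g y := by
  change (mfderiv I 𝓘(ℝ, ℝ) f y : TangentSpace I y →L[ℝ] ℝ) = mfderiv I 𝓘(ℝ, ℝ) g y
  exact h.mfderiv_eq

/-- The framed geometry formed by the smooth vector fields over the domain of an orthonormal
frame. -/
noncomputable def IsOrthonormalFrame.geometry (he : IsOrthonormalFrame s e) :
    FramedGeometry (smoothOn I s) (fieldsOn I s) (Fin (Module.finrank ℝ E)) where
  D :=
    { toFun := he.deriv
      map_add' := fun U V ↦ by
        ext f y
        exact map_add (mvfderiv I f.1 y) (U.1 y) (V.1 y)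
      map_smul' := fun c V ↦ by
        ext f y
        exact map_smul (mvfderiv I f.1 y) (c.1 y) (V.1 y) }
  N :=
    { toFun := he.conn
      map_add' := fun U V ↦ by
        ext W y
        exact map_add (leviCivita I M W.1 y) (U.1 y) (V.1 y)
      map_smul' := fun c V ↦ by
        ext W y
        exact map_smul (leviCivita I M W.1 y) (c.1 y) (V.1 y) }
  g := metricOn I s
  e i := ⟨e i, he.contMDiffOn i, he.eq_zero i⟩
  leibniz U V f := by
    ext y
    change leviCivitaFun (f.1 • V.1) y (U.1 y)
      = f.1 y • leviCivitaFun V.1 y (U.1 y) + mvfderiv I f.1 y (U.1 y) • V.1 y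
    by_cases hy : y ∈ s
    · rw [isCovariantDerivativeOn_leviCivitaFun.leibniz
        (mdiffAt_of_contMDiffOn he.isOpen V.2.1 hy) (mdiffAt_fun_of_contMDiffOn he.isOpen f.2 hy)]
      rfl
    · simp [U.2.2 y hy]
  g_comm U V := by
    ext y
    exact real_inner_comm _ _
  metric U V W := by
    ext y
    change mvfderiv I (fun y ↦ inner ℝ (V.1 y) (W.1 y)) y (U.1 y)
      = inner ℝ (leviCivita I M V.1 y (U.1 y)) (W.1 y)
        + inner ℝ (V.1 y) (leviCivita I M W.1 y (U.1 y))
    by_cases hy : y ∈ s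
    · exact leviCivita_metric (mdiffAt_of_contMDiffOn he.isOpen U.2.1 hy)
        (mdiffAt_of_contMDiffOn he.isOpen V.2.1 hy) (mdiffAt_of_contMDiffOn he.isOpen W.2.1 hy)
    · simp [U.2.2 y hy]
  D_comm U V f := by
    ext y
    change mvfderiv I (fun y ↦ mvfderiv I f.1 y (V.1 y)) y (U.1 y)
      - mvfderiv I (fun y ↦ mvfderiv I f.1 y (U.1 y)) y (V.1 y)
      = mvfderiv I f.1 y (leviCivita I M V.1 y (U.1 y) - leviCivita I M U.1 y (V.1 y))
    by_cases hy : y ∈ s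
    · rw [he.mvfderiv_comm f.2 U.2.1 V.2.1 hy, mlieBracket_eq_sub he.isOpen U.2.1 V.2.1 hy]
    · simp [U.2.2 y hy, V.2.2 y hy]
  jacobi U V W := by
    -- The bracket and the difference of covariant derivatives agree on `s` only; as `s` is open,
    -- that is enough to take a further bracket at `y`.
    have hbr (A B C : fieldsOn I s) {y : M} (hy : y ∈ s) :
        (he.conn A (he.conn B C - he.conn C B) - he.conn (he.conn B C - he.conn C B) A).1 y
          = mlieBracket I A.1 (mlieBracket I B.1 C.1) y := by
      rw [mlieBracket_congr he.isOpen hy (fun _ _ ↦ rfl)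
        (V' := (he.conn B C - he.conn C B).1)
        (fun z hz ↦ mlieBracket_eq_sub he.isOpen B.2.1 C.2.1 hz),
        mlieBracket_eq_sub he.isOpen A.2.1 (he.conn B C - he.conn C B).2.1 hy]
      rfl
    apply Subtype.ext
    funext y
    by_cases hy : y ∈ s
    · refine (congrArg₂ (· + ·) (congrArg₂ (· + ·) (hbr U V W hy) (hbr V W U hy))
        (hbr W U V hy)).trans ?_
      have h1 : mlieBracket I V.1 (mlieBracket I W.1 U.1) y
          = (-1 : ℝ) • mlieBracket I V.1 (mlieBracket I U.1 W.1) y := by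
        rw [← mlieBracket_const_smul_right (mdiffAt_of_contMDiffOn he.isOpen
          (contMDiffOn_mlieBracket he.isOpen U.2.1 W.2.1) hy)]
        refine mlieBracket_congr he.isOpen hy (fun _ _ ↦ rfl) fun z _ ↦ ?_
        rw [mlieBracket_swap_apply]
        exact (neg_one_smul ℝ _).symm
      change mlieBracket I U.1 (mlieBracket I V.1 W.1) y
        + mlieBracket I V.1 (mlieBracket I W.1 U.1) y
        + mlieBracket I W.1 (mlieBracket I U.1 V.1) y = 0
      rw [mlieBracket_jacobi he.isOpen U.2.1 V.2.1 W.2.1 hy, h1,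
        mlieBracket_swap_apply (V := mlieBracket I U.1 V.1)]
      module
    -- The Jacobi sum is itself an element of `fieldsOn`, hence zero off `s`.
    · exact (_ : fieldsOn I s).2.2 y hy
  sum_frame V := by
    apply Subtype.ext
    funext y
    rw [AddSubmonoidClass.coe_finsetSum, Finset.sum_apply]
    change ∑ i, (inner ℝ (V.1 y) (e i y) : ℝ) • e i y = V.1 y
    by_cases hy : y ∈ s
    · exact he.sum_inner_smul hy _
    · simp [V.2.2 y hy]
  -- The products `g (e i) (e j)` are Kronecker deltas on `s` but zero off `s`, so only the
  -- vanishing of their derivatives holds everywhere.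
  D_frame U i j := by
    ext y
    change mvfderiv I (fun y ↦ inner ℝ (e i y) (e j y)) y (U.1 y) = 0
    by_cases hy : y ∈ s
    · have h : (fun y ↦ (inner ℝ (e i y) (e j y) : ℝ)) =ᶠ[𝓝 y] fun _ ↦ if i = j then 1 else 0 :=
        Filter.eventually_of_mem (he.isOpen.mem_nhds hy) fun z hz ↦
          orthonormal_iff_ite.1 (he.orthonormal z hz) i j
      rw [mvfderiv_congr h, mvfderiv_const, zero_apply]
    · simp [U.2.2 y hy]

theorem fieldsOn_sum_apply {ι : Type*} (t : Finset ι) (V : ι → fieldsOn I s) (y : M) :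
    (∑ i ∈ t, V i).1 y = ∑ i ∈ t, (V i).1 y := by
  rw [AddSubmonoidClass.coe_finsetSum, Finset.sum_apply]

theorem smoothOn_sum_apply {ι : Type*} (t : Finset ι) (f : ι → smoothOn I s) (y : M) :
    (∑ i ∈ t, f i).1 y = ∑ i ∈ t, (f i).1 y := by
  rw [AddSubmonoidClass.coe_finsetSum, Finset.sum_apply]

theorem IsOrthonormalFrame.geometry_g_apply (he : IsOrthonormalFrame s e) (U V : fieldsOn I s)
    (y : M) : (he.geometry.g U V).1 y = inner ℝ (U.1 y) (V.1 y) := rfl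

theorem IsOrthonormalFrame.geometry_N_apply (he : IsOrthonormalFrame s e) (U V : fieldsOn I s)
    (y : M) : (he.geometry.N U V).1 y = leviCivita I M V.1 y (U.1 y) := rfl

theorem IsOrthonormalFrame.geometry_D_apply (he : IsOrthonormalFrame s e) (U : fieldsOn I s)
    (f : smoothOn I s) (y : M) : (he.geometry.D U f).1 y = mvfderiv I f.1 y (U.1 y) := rfl

theorem IsOrthonormalFrame.geometry_e_apply (he : IsOrthonormalFrame s e)
    (i : Fin (Module.finrank ℝ E)) (y : M) : (he.geometry.e i).1 y = e i y := rfl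

/-! ### Tensoriality and comparison with the pointwise curvature. -/

/-- A linear operator on vector fields is determined pointwise. -/
theorem IsOrthonormalFrame.linear_apply_congr (he : IsOrthonormalFrame s e)
    (φ : fieldsOn I s →ₗ[smoothOn I s] fieldsOn I s) {U V : fieldsOn I s} {y : M}
    (h : U.1 y = V.1 y) : (φ U).1 y = (φ V).1 y := by
  have key (U : fieldsOn I s) :
      (φ U).1 y = ∑ i, (inner ℝ (U.1 y) (e i y) : ℝ) • (φ (he.geometry.e i)).1 y := by
    conv_lhs => rw [← he.geometry.sum_frame U]
    rw [map_sum, fieldsOn_sum_apply]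
    exact Finset.sum_congr rfl fun i _ ↦ by rw [map_smul]; rfl
  rw [key U, key V, h]

theorem IsOrthonormalFrame.geometry_R_apply (he : IsOrthonormalFrame s e) (U V W : fieldsOn I s)
    {y : M} (hy : y ∈ s) : (he.geometry.R U V W).1 y = curvature U.1 V.1 W.1 y := by
  rw [curvature, mlieBracket_eq_sub he.isOpen U.2.1 V.2.1 hy]
  rfl

theorem IsOrthonormalFrame.geometry_R_congr (he : IsOrthonormalFrame s e)
    {U U' V V' W W' : fieldsOn I s} {y : M} (hU : U.1 y = U'.1 y) (hV : V.1 y = V'.1 y)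
    (hW : W.1 y = W'.1 y) : (he.geometry.R U V W).1 y = (he.geometry.R U' V' W').1 y := by
  rw [he.linear_apply_congr (he.geometry.R U V) hW, ← FramedGeometry.RSnd_apply,
    he.linear_apply_congr (he.geometry.RSnd U W') hV, FramedGeometry.RSnd_apply,
    ← FramedGeometry.RFst_apply, he.linear_apply_congr (he.geometry.RFst V' W') hU,
    FramedGeometry.RFst_apply]

/-- The restriction to `s` of a vector field that is smooth on `s`. -/
noncomputable def toFieldsOn (s : Set M) (V : Π x : M, TangentSpace I x) (hV : CMDiff[s] ∞ (T% V)) :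
    fieldsOn I s :=
  ⟨restrictField s V, contMDiffOn_restrictField hV, fun _ hx ↦ restrictField_of_notMem V hx⟩

theorem toFieldsOn_apply {V : Π x : M, TangentSpace I x} (hV : CMDiff[s] ∞ (T% V)) {y : M}
    (hy : y ∈ s) : (toFieldsOn s V hV).1 y = V y := restrictField_of_mem V hy

theorem IsOrthonormalFrame.curvature_congr (he : IsOrthonormalFrame s e)
    {U U' V V' W W' : Π x : M, TangentSpace I x} (hU : CMDiff[s] ∞ (T% U))
    (hU' : CMDiff[s] ∞ (T% U')) (hV : CMDiff[s] ∞ (T% V)) (hV' : CMDiff[s] ∞ (T% V'))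
    (hW : CMDiff[s] ∞ (T% W)) (hW' : CMDiff[s] ∞ (T% W')) (hUU : ∀ y ∈ s, U y = U' y)
    (hVV : ∀ y ∈ s, V y = V' y) (hWW : ∀ y ∈ s, W y = W' y) {y : M} (hy : y ∈ s) :
    curvature U V W y = curvature U' V' W' y := by
  have h {V V' : Π x : M, TangentSpace I x} (hV : CMDiff[s] ∞ (T% V))
      (hV' : CMDiff[s] ∞ (T% V')) (hVV : ∀ y ∈ s, V y = V' y) :
      leviCivita I M (fun y ↦ leviCivita I M W y (V y)) y
        = leviCivita I M (fun y ↦ leviCivita I M W' y (V' y)) y :=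
    leviCivita_congr he.isOpen (he.contMDiffOn_leviCivita hV hW)
      (he.contMDiffOn_leviCivita hV' hW') (fun z hz ↦ by
        rw [leviCivita_congr he.isOpen hW hW' hWW hz, hVV z hz]) hy
  rw [curvature, curvature, h hV hV' hVV, h hU hU' hUU, hUU y hy, hVV y hy,
    leviCivita_congr he.isOpen hW hW' hWW hy, mlieBracket_congr he.isOpen hy hUU hVV]

/-- The curvature is a tensor. -/
theorem curvature_tensorial {u : Set M} (hu : IsOpen u) {y : M} (hy : y ∈ u)
    {U U' V V' W W' : Π x : M, TangentSpace I x} (hU : CMDiff[u] ∞ (T% U))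
    (hU' : CMDiff[u] ∞ (T% U')) (hV : CMDiff[u] ∞ (T% V)) (hV' : CMDiff[u] ∞ (T% V'))
    (hW : CMDiff[u] ∞ (T% W)) (hW' : CMDiff[u] ∞ (T% W')) (hUU : U y = U' y) (hVV : V y = V' y)
    (hWW : W y = W' y) : curvature U V W y = curvature U' V' W' y := by
  obtain ⟨s, hsu, e, hys, he⟩ := exists_isOrthonormalFrame (I := I) hu hy
  -- By locality the fields may be cut off outside a frame domain inside `u`; there curvature is
  -- linear over functions, hence pointwise.
  have hr {U V W : Π x : M, TangentSpace I x} (hU : CMDiff[s] ∞ (T% U)) (hV : CMDiff[s] ∞ (T% V))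
      (hW : CMDiff[s] ∞ (T% W)) : curvature U V W y
        = (he.geometry.R (toFieldsOn s U hU) (toFieldsOn s V hV) (toFieldsOn s W hW)).1 y := by
    rw [he.geometry_R_apply _ _ _ hys]
    exact he.curvature_congr hU (toFieldsOn s U hU).2.1 hV (toFieldsOn s V hV).2.1 hW
      (toFieldsOn s W hW).2.1 (fun z hz ↦ (toFieldsOn_apply hU hz).symm)
      (fun z hz ↦ (toFieldsOn_apply hV hz).symm) (fun z hz ↦ (toFieldsOn_apply hW hz).symm) hys
  rw [hr (hU.mono hsu) (hV.mono hsu) (hW.mono hsu), hr (hU'.mono hsu) (hV'.mono hsu) (hW'.mono hsu)]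
  refine he.geometry_R_congr ?_ ?_ ?_ <;> simpa only [toFieldsOn_apply _ hys]

theorem contMDiffOn_extend {x : M} (v : TangentSpace I x) :
    CMDiff[(trivializationAt E (TangentSpace I) x).baseSet] ∞ (T% (extend E v)) := by
  set t := trivializationAt E (TangentSpace I) x
  intro y hy
  rw [t.contMDiffWithinAt_section _ hy]
  refine (contMDiffOn_const (c := (t ⟨x, v⟩).2)).congr (fun z hz ↦ ?_) y hy
  change (t ⟨z, t.symm z (t ⟨x, v⟩).2⟩).2 = _
  rw [t.apply_mk_symm hz]

/-- The extensions in `riemannTensor` are smooth only near `y` and differ from the given fields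
elsewhere; tensoriality makes both irrelevant. -/
theorem IsOrthonormalFrame.riemannTensor_apply (he : IsOrthonormalFrame s e)
    (U V W : fieldsOn I s) {y : M} (hy : y ∈ s) :
    riemannTensor y (U.1 y) (V.1 y) (W.1 y) = (he.geometry.R U V W).1 y := by
  rw [he.geometry_R_apply U V W hy, riemannTensor]
  set t := trivializationAt E (TangentSpace I) y
  refine curvature_tensorial (t.open_baseSet.inter he.isOpen)
    ⟨FiberBundle.mem_baseSet_trivializationAt' y, hy⟩
    ((contMDiffOn_extend _).mono Set.inter_subset_left) (U.2.1.mono Set.inter_subset_right)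
    ((contMDiffOn_extend _).mono Set.inter_subset_left) (V.2.1.mono Set.inter_subset_right)
    ((contMDiffOn_extend _).mono Set.inter_subset_left) (W.2.1.mono Set.inter_subset_right)
    ?_ ?_ ?_ <;> exact extend_apply_self _ _

theorem IsOrthonormalFrame.exists_field (he : IsOrthonormalFrame s e) {y : M} (hy : y ∈ s)
    (v : TangentSpace I y) : ∃ V : fieldsOn I s, V.1 y = v := by
  refine ⟨∑ i, algebraMap ℝ (smoothOn I s) (inner ℝ v (e i y)) • he.geometry.e i, ?_⟩
  rw [fieldsOn_sum_apply]
  exact he.sum_inner_smul hy v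

/-! ### Traces, norms, gradient and Laplacian in the frame. -/

/-- Traces of bilinear forms may be computed in any orthonormal basis. -/
theorem IsOrthonormalFrame.trace_eq (he : IsOrthonormalFrame s e)
    (T : fieldsOn I s →ₗ[smoothOn I s] fieldsOn I s →ₗ[smoothOn I s] smoothOn I s) {y : M}
    (hy : y ∈ s) {ι : Type*} [Fintype ι] (b : OrthonormalBasis ι ℝ (TangentSpace I y))
    (B : ι → fieldsOn I s) (hB : ∀ k, (B k).1 y = b k) :
    ∑ k, (T (B k) (B k)).1 y = (∑ i, T (he.geometry.e i) (he.geometry.e i)).1 y := by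
  have hexp (U : fieldsOn I s) : (T U U).1 y = ∑ i, ∑ j, (inner ℝ (U.1 y) (e i y) : ℝ)
      * inner ℝ (U.1 y) (e j y) * (T (he.geometry.e i) (he.geometry.e j)).1 y := by
    conv_lhs => rw [← he.geometry.sum_frame U]
    simp only [map_sum, LinearMap.sum_apply, map_smul, LinearMap.smul_apply, smoothOn_sum_apply,
      Finset.smul_sum]
    rw [Finset.sum_comm]
    refine Finset.sum_congr rfl fun i _ ↦ Finset.sum_congr rfl fun j _ ↦ ?_
    rw [mul_assoc, mul_left_comm]
    rfl
  have ho := orthonormal_iff_ite.1 (he.orthonormal y hy)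
  simp only [hexp, hB]
  rw [Finset.sum_comm, smoothOn_sum_apply]
  refine Finset.sum_congr rfl fun i _ ↦ ?_
  rw [Finset.sum_comm]
  -- Parseval in the basis `b` for the orthonormal vectors `e i y`, `e j y`.
  have h (j) : ∑ k, (inner ℝ (b k) (e i y) : ℝ) * inner ℝ (b k) (e j y)
      * (T (he.geometry.e i) (he.geometry.e j)).1 y
      = if i = j then (T (he.geometry.e i) (he.geometry.e j)).1 y else 0 := by
    rw [← Finset.sum_mul]
    have h1 := b.sum_inner_mul_inner (e i y) (e j y)
    rw [ho i j] at h1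
    simp only [real_inner_comm (b _) (e i y)] at h1 ⊢
    rw [h1]
    simp
  simp [h]

theorem IsOrthonormalFrame.ricci_apply (he : IsOrthonormalFrame s e) (U V : fieldsOn I s) {y : M}
    (hy : y ∈ s) : ricci y (U.1 y) (V.1 y) = (he.geometry.Ric U V).1 y := by
  choose B hB using fun k ↦ he.exists_field hy (onb I y k)
  have h := he.trace_eq (he.geometry.curvForm U V) hy (onb I y) B hB
  simp only [FramedGeometry.curvForm_apply] at h
  rw [FramedGeometry.Ric_apply, ← h, ricci]
  refine Finset.sum_congr rfl fun k _ ↦ ?_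
  rw [← hB k, he.riemannTensor_apply _ _ _ hy]
  rfl

theorem IsOrthonormalFrame.scalarCurvature_eq (he : IsOrthonormalFrame s e) {y : M}
    (hy : y ∈ s) : scalarCurvature I y = he.geometry.S.1 y := by
  choose B hB using fun k ↦ he.exists_field hy (onb I y k)
  rw [FramedGeometry.S, ← he.trace_eq he.geometry.Ric hy (onb I y) B hB, scalarCurvature]
  refine Finset.sum_congr rfl fun k _ ↦ ?_
  rw [← hB k, he.ricci_apply _ _ hy]

/-- Basis independence of traces is used one slot at a time, for the forms `(V, V') ↦ Ric(U,V)
Ric(U,V')` and their transposes. -/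
theorem IsOrthonormalFrame.normSq_ricci (he : IsOrthonormalFrame s e) {y : M} (hy : y ∈ s) :
    normSq (fun u v : TangentSpace I y ↦ ricci y u v)
      = (∑ i, ∑ j, he.geometry.Ric (he.geometry.e i) (he.geometry.e j) ^ 2).1 y := by
  choose B hB using fun k ↦ he.exists_field hy (onb I y k)
  set G := he.geometry
  have h1 (U : fieldsOn I s) : ∑ l, (G.Ric U (B l) ^ 2).1 y = (∑ j, G.Ric U (G.e j) ^ 2).1 y := by
    have h := he.trace_eq ((LinearMap.mul (smoothOn I s) (smoothOn I s)).compl₁₂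
      (G.Ric U) (G.Ric U)) hy (onb I y) B hB
    simpa only [LinearMap.compl₁₂_apply, LinearMap.mul_apply', ← sq] using h
  have h2 (U : fieldsOn I s) : ∑ l, (G.Ric (B l) U ^ 2).1 y = (∑ j, G.Ric (G.e j) U ^ 2).1 y := by
    have h := he.trace_eq ((LinearMap.mul (smoothOn I s) (smoothOn I s)).compl₁₂
      (G.Ric.flip U) (G.Ric.flip U)) hy (onb I y) B hB
    simpa only [LinearMap.compl₁₂_apply, LinearMap.mul_apply', LinearMap.flip_apply, ← sq] using h
  have h3 : normSq (fun u v : TangentSpace I y ↦ ricci y u v)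
      = ∑ k, ∑ l, (G.Ric (B k) (B l) ^ 2).1 y := by
    refine Finset.sum_congr rfl fun k _ ↦ Finset.sum_congr rfl fun l _ ↦ ?_
    change ricci y (onb I y k) (onb I y l) ^ 2 = _
    rw [← hB k, ← hB l, he.ricci_apply _ _ hy]
    rfl
  rw [h3]
  simp only [h1, smoothOn_sum_apply]
  rw [Finset.sum_comm]
  simp only [h2, smoothOn_sum_apply]
  exact Finset.sum_comm

theorem inner_gradient (f : M → ℝ) (x : M) (v : TangentSpace I x) :
    inner ℝ (gradient I f x) v = mvfderiv I f x v := by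
  conv_rhs => rw [← (onb I x).sum_repr' v]
  simp [gradient, sum_inner, inner_smul_left, mul_comm]

theorem IsOrthonormalFrame.gradient_eq (he : IsOrthonormalFrame s e) {f : M → ℝ}
    (F : smoothOn I s) (hF : ∀ y ∈ s, f y = F.1 y) {y : M} (hy : y ∈ s) :
    gradient I f y = (he.geometry.grad F).1 y := by
  refine ext_inner_right ℝ fun v ↦ ?_
  obtain ⟨V, rfl⟩ := he.exists_field hy v
  rw [inner_gradient, mvfderiv_congr (Filter.eventually_of_mem (he.isOpen.mem_nhds hy) hF),
    ← he.geometry_g_apply, FramedGeometry.g_grad, he.geometry_D_apply]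

theorem IsOrthonormalFrame.laplacian_eq (he : IsOrthonormalFrame s e) {f : M → ℝ}
    (F : smoothOn I s) (hF : ∀ y ∈ s, f y = F.1 y) {y : M} (hy : y ∈ s) :
    laplacian I f y = (he.geometry.div (he.geometry.grad F)).1 y := by
  choose B hB using fun k ↦ he.exists_field hy (onb I y k)
  have hg : CMDiff[s] ∞ (T% (gradient I f)) := (he.geometry.grad F).2.1.congr fun z hz ↦ by
    rw [he.gradient_eq F hF hz]
  have h := he.trace_eq (he.geometry.nabla (he.geometry.grad F)) hy (onb I y) B hB
  simp only [FramedGeometry.nabla_apply] at h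
  rw [FramedGeometry.div, ← h, laplacian, divergence]
  refine Finset.sum_congr rfl fun k _ ↦ ?_
  rw [leviCivita_congr he.isOpen hg (he.geometry.grad F).2.1
    (fun z hz ↦ he.gradient_eq F hF hz) hy, he.geometry_g_apply, hB k, he.geometry_N_apply, hB k]

/-! ### The soliton equation in the frame, and the conclusion. -/

theorem lieDerivMetric_eq {X : Π x : M, TangentSpace I x} {x : M} (hX : MDiffAt (T% X) x)
    (u v : TangentSpace I x) : lieDerivMetric X x u v
      = inner ℝ (leviCivita I M X x u) v + inner ℝ (leviCivita I M X x v) u := by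
  have hu := mdifferentiableAt_extend I E u
  have hv := mdifferentiableAt_extend I E v
  have ht {Y Z : Π x : M, TangentSpace I x} (hY : MDiffAt (T% Y) x) (hZ : MDiffAt (T% Z) x) :=
    (CovariantDerivative.torsion_eq_zero_iff _).1 (leviCivita_torsion (I := I) (M := M)) hY hZ
  -- After metric compatibility and torsion-freeness, the derivatives along `X` of the two
  -- extensions cancel.
  rw [lieDerivMetric, leviCivita_metric hX hu hv, ← ht hX hu, ← ht hX hv]
  simp only [extend_apply_self, inner_sub_left, inner_sub_right]
  rw [real_inner_comm u (leviCivita I M X x v)]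
  ring

theorem contMDiff_scalarCurvature :
    ContMDiff I 𝓘(ℝ, ℝ) ∞ (scalarCurvature I : M → ℝ) := by
  intro x
  obtain ⟨s, -, e, hx, he⟩ := exists_isOrthonormalFrame (I := I) isOpen_univ (Set.mem_univ x)
  have h : CMDiff[s] ∞ (scalarCurvature I : M → ℝ) :=
    ContMDiffOn.congr (f := he.geometry.S.1) he.geometry.S.2 fun y hy ↦ he.scalarCurvature_eq hy
  exact h.contMDiffAt (he.isOpen.mem_nhds hx)

theorem IsRicciSoliton.geometry_eq {X : Π x : M, TangentSpace I x} {lam : ℝ}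
    (hX : IsRicciSoliton X lam) (he : IsOrthonormalFrame s e) (U V : fieldsOn I s) :
    2 * he.geometry.Ric U V
      + (he.geometry.g (he.geometry.N U (toFieldsOn s X hX.contMDiff.contMDiffOn)) V
        + he.geometry.g (he.geometry.N V (toFieldsOn s X hX.contMDiff.contMDiffOn)) U)
      = 2 * algebraMap ℝ (smoothOn I s) lam * he.geometry.g U V := by
  set X' := toFieldsOn s X hX.contMDiff.contMDiffOn with hX'
  apply Subtype.ext
  funext y
  change 2 * (he.geometry.Ric U V).1 y + (inner ℝ (leviCivita I M X'.1 y (U.1 y)) (V.1 y)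
    + inner ℝ (leviCivita I M X'.1 y (V.1 y)) (U.1 y)) = 2 * lam * inner ℝ (U.1 y) (V.1 y)
  by_cases hy : y ∈ s
  · have h := hX.eq y (U.1 y) (V.1 y)
    rw [lieDerivMetric_eq (mdiffAt_of_contMDiffOn he.isOpen hX.contMDiff.contMDiffOn hy),
      leviCivita_congr he.isOpen hX.contMDiff.contMDiffOn X'.2.1
        (fun z hz ↦ (toFieldsOn_apply _ hz).symm) hy, he.ricci_apply U V hy] at h
    linarith
  -- Off `s` the frame vanishes, so every trace over it does too.
  · have hR : (he.geometry.Ric U V).1 y = 0 := by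
      rw [FramedGeometry.Ric_apply, smoothOn_sum_apply]
      refine Finset.sum_eq_zero fun i _ ↦ ?_
      rw [he.geometry_g_apply, he.geometry_e_apply, he.eq_zero i y hy, inner_zero_right]
    simp [hR, U.2.2 y hy, V.2.2 y hy]

theorem IsRicciSoliton.laplacian_scalarCurvature {X : Π x : M, TangentSpace I x} {lam : ℝ}
    (hX : IsRicciSoliton X lam) (x : M) :
    1 / 2 * laplacian I (scalarCurvature I) x
      = 1 / 2 * inner ℝ (gradient I (scalarCurvature I) x) (X x) + lam * scalarCurvature I x
        - normSq (fun u v : TangentSpace I x ↦ ricci x u v) := by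
  obtain ⟨s, -, e, hx, he⟩ := exists_isOrthonormalFrame (I := I) isOpen_univ (Set.mem_univ x)
  have h := congrArg (fun f ↦ f.1 x) (he.geometry.div_grad_S _ lam (hX.geometry_eq he))
  have hS (y : M) (hy : y ∈ s) := he.scalarCurvature_eq hy
  have hD : (he.geometry.D (toFieldsOn s X hX.contMDiff.contMDiffOn) he.geometry.S).1 x
      = inner ℝ (gradient I (scalarCurvature I) x) (X x) := by
    rw [inner_gradient, mvfderiv_congr (Filter.eventually_of_mem (he.isOpen.mem_nhds hx) hS),
      he.geometry_D_apply, toFieldsOn_apply _ hx]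
  change (he.geometry.div (he.geometry.grad he.geometry.S)).1 x
    = (he.geometry.D (toFieldsOn s X hX.contMDiff.contMDiffOn) he.geometry.S).1 x
      + 2 * lam * he.geometry.S.1 x - 2 * (∑ i, ∑ j,
        he.geometry.Ric (he.geometry.e i) (he.geometry.e j) ^ 2).1 x at h
  rw [← he.laplacian_eq _ hS hx, hD, ← he.normSq_ricci hx, ← hS x hx] at h
  linarith

/-- The decomposition of the squared norm of a bilinear form into trace and traceless parts. -/
theorem normSq_sub_trace {x : M} (B : TangentSpace I x → TangentSpace I x → ℝ) {m : ℕ}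
    (hm : Module.finrank ℝ E = m) :
    (∑ i, B (onb I x i) (onb I x i)) ^ 2 / m + normSq (fun u v : TangentSpace I x ↦
      B u v - (∑ i, B (onb I x i) (onb I x i)) / m * inner ℝ u v) = normSq B := by
  set S := ∑ i, B (onb I x i) (onb I x i) with hS
  have ho := orthonormal_iff_ite.1 (onb I x).orthonormal
  -- In an orthonormal basis only the diagonal entries change.
  have h (i j) : (B (onb I x i) (onb I x j) - S / m * inner ℝ (onb I x i) (onb I x j)) ^ 2
      = B (onb I x i) (onb I x j) ^ 2
        + if i = j then (S / m) ^ 2 - 2 * (S / m) * B (onb I x i) (onb I x j) else 0 := by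
    rw [ho]; split_ifs <;> ring
  have hcard : Module.finrank ℝ (TangentSpace I x) = m := hm
  simp only [normSq, h, Finset.sum_add_distrib, Finset.sum_ite_eq, Finset.mem_univ, if_true,
    Finset.sum_sub_distrib, ← Finset.mul_sum, ← hS, Finset.sum_const, Finset.card_univ,
    Fintype.card_fin, hcard, nsmul_eq_mul]
  rcases eq_or_ne (m : ℝ) 0 with h0 | h0
  -- For `m = 0` both quotients are zero by the convention for division, so nothing is subtracted.
  · simp [h0]
  · field_simp
    ring

end Riem

theorem mainTheorem9 {E : Type*} [NormedAddCommGroup E] [NormedSpace ℝ E] [FiniteDimensional ℝ E]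
    {H : Type*} [TopologicalSpace H] {I : ModelWithCorners ℝ E H} [I.Boundaryless]
    {M : Type*} [TopologicalSpace M] [ChartedSpace H M] [IsManifold I ∞ M]
    [RiemannianBundle (fun x : M ↦ TangentSpace I x)]
    [IsContMDiffRiemannianBundle I ∞ E (fun x : M ↦ TangentSpace I x)]
    (m : ℕ) (hm : Module.finrank ℝ E = m)
    (X : Π x : M, TangentSpace I x) (lam : ℝ) (hX : Riem.IsRicciSoliton X lam) :
    ContMDiff I 𝓘(ℝ, ℝ) ∞ (Riem.scalarCurvature I : M → ℝ) ∧
    ∀ x : M,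
      1 / 2 * Riem.laplacian I (Riem.scalarCurvature I) x
        = 1 / 2 * inner ℝ (Riem.gradient I (Riem.scalarCurvature I) x) (X x)
          + lam * Riem.scalarCurvature I x
          - Riem.normSq (fun u v : TangentSpace I x ↦ Riem.ricci x u v) ∧
      1 / 2 * Riem.laplacian I (Riem.scalarCurvature I) x
        = 1 / 2 * inner ℝ (Riem.gradient I (Riem.scalarCurvature I) x) (X x)
          + lam * Riem.scalarCurvature I x
          - Riem.scalarCurvature I x ^ 2 / m
          - Riem.normSq (fun u v : TangentSpace I x ↦
              Riem.ricci x u v - Riem.scalarCurvature I x / m * inner ℝ u v) := by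
  refine ⟨Riem.contMDiff_scalarCurvature, fun x ↦ ⟨hX.laplacian_scalarCurvature x, ?_⟩⟩
  have h := Riem.normSq_sub_trace (fun u v : TangentSpace I x ↦ Riem.ricci x u v) hm
  rw [hX.laplacian_scalarCurvature x, ← h]
  simp only [Riem.scalarCurvature]
  ring
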